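/- **Conventions.** A *Lorentzian pre-length space* $(Y,d,\ll,\le,\tau)$ is a separable metric space $(Y,d)$ with a reflexive and transitive relation $\le$, a transitive relation $\ll$ contained in $\le$, and a lower semicontinuous $\tau:Y\times Y\to[0,\infty]$ such that $\tau(x,y)=0$ if $x\not\le y$; $\tau(x,y)>0$ iff $x\ll y$; and $\tau(x,z)\ge\tau(x,y)+\tau(y,z)$ if $x\le y\le z$. Put $\ell(x,y)=\tau(x,y)$ if $x\le y$ and $\ell(x,y)=-\infty$ otherwise. A (future directed) *causal curve* is a locally Lipschitz curve $\gamma$ on an interval with $\gamma(s)\le\gamma(t)$ for $s\le t$; its $\tau$-length on $[a,b]$ is $L_\tau(\gamma)=\inf\sum_i\tau(\gamma(t_i),\gamma(t_{i+1}))$ over all partitions of $[a,b]$. The space is a *Lorentzian geodesic space* if every point has a neighbourhood $U$ and a constant $C$ such that every future or past directed causal curve in $U$ has $d$-length at most $C$, and if any $x\le y$, $x\ne y$, are joined by a future directed causal curve $\gamma$ with $L_\tau(\gamma)=\tau(x,y)$. A *proper cover* of $Y$ is a sequence of sets $U^0\subset U^1\subset\cdots$ with union $Y$ such that each closure $\overline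 U^k$ is compact and $\sup_{U^k\times U^k}\tau<\infty$. *Curvature.* For $K\in\mathbb R$ let $\mathbb L^2(K)$ be the two-dimensional Lorentzian model space of constant curvature $K$ (the universal cover of the pseudosphere of radius $1/\sqrt K$ if $K>0$, the Minkowski plane if $K=0$, the universal cover of the pseudohyperbolic space of radius $1/\sqrt{-K}$ if $K<0$), with time separation $\bar\tau$, and let $\pi_{-K}=\pi/\sqrt{-K}$ if $K<0$, $\pi_{-K}=\infty$ if $K\ge0$. An open set $U\subset Y$ is a *$\ge K$-comparison neighbourhood* if (i) $(U\times U)\cap\tau^{-1}([0,\pi_{-K}))$ is open and $\tau$ is continuous on it; (ii) whenever $y\ll x\ll z_1\le z_2$ in $U$ with $\tau(y,z_2)<\pi_{-K}$, and $\bar y,\bar x,\bar z_1,\bar z_2\in\mathbb L^2(K)$ satisfy $\bar\tau(\bar y,\bar x)=\tau(y,x)$, $\bar\tau(\bar y,\bar z_j)=\tau(y,z_j)$, $\bar\tau(\bar x,\bar z_j)=\tau(x,z_j)$ for $j=1,2$, with $\bar z_1,\bar z_2$ on opposite (closed) sides of the geodesic line through $\bar y,\bar x$, then $\tau(z_1,z_2)\ge\bar\tau(\bar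 z_1,\bar z_2)$; and likewise, whenever $z_2\le z_1\ll x\ll y$ in $U$ with $\tau(z_2,y)<\pi_{-K}$, and $\bar z_2,\bar z_1,\bar x,\bar y$ is a comparison configuration in the same (time-reversed) sense, then $\tau(z_2,z_1)\ge\bar\tau(\bar z_2,\bar z_1)$. $Y$ has *timelike sectional curvature bounded below by $K$* if it is covered by $\ge K$-comparison neighbourhoods, and *globally* so if $Y$ itself is a $\ge K$-comparison neighbourhood. *Convergence.* A $\delta$-*GH isometry* $\phi:A\to B$ between metric spaces is a map with $|d(\phi(x),\phi(y))-d(x,y)|<\delta$ for all $x,y\in A$ such that every point of $B$ has distance less than $\delta$ from $\phi(A)$. Let $Y_i$ $(i\in\mathbb N)$ and $Y$ be Lorentzian pre-length spaces with proper covers $(U_i^k)_k$ and $(U^k)_k$. Then $Y_i$ *$\ell$-converges* to $Y$ if the following hold. (a) For every $k$ there is $C(k)$ such that, for all $i$, every causal curve in $U_i^k$ has $d_i$-length at most $C(k)$. (b) For every $k$ there are maps $\phi_i^k$ such that for every $\delta>0$ the map $\phi^k_i:\overline U{}_i^k\to\overline U{}^k$ is a $\delta$-GH isometry for all large $i$.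 (c) These maps can be chosen such that, for all $k,l\in\mathbb N$ with $l\geq 1$ and all $\varepsilon\in(0,\frac1{2l})$, there are $\delta>0$ and $i_0$ such that for all $i\ge i_0$, all $x_i,y_i\in\overline U{}_i^k$ and all $x,y\in\overline U{}^k$ with $d(\phi_i^k(x_i),x)+d(\phi_i^k(y_i),y)\le\delta$: if $\ell_i(x_i,y_i)\ge0$, then $\ell_i(x_i,y_i)\le\max\{\ell(x,y),0\}+\varepsilon$; and if $\ell(x,y)\ge\frac1l$, then $\ell_i(x_i,y_i)\ge\ell(x,y)-\varepsilon$. **Theorem.** Let $K\in\mathbb R$. Let $Y_i$, $i\in\mathbb N$, be Lorentzian geodesic spaces with proper covers $(U_i^k)_k$ that have globally timelike sectional curvature bounded below by $K$, and let $Y$ be a Lorentzian geodesic space with a proper cover $(U^k)_k$ such that every point of $Y$ has a neighbourhood contained in some $\overline U{}^k$. If $Y_i$ $\ell$-converges to $Y$ with respect to these covers, then $Y$ has timelike sectional curvature bounded below by $K$. -/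

import Mathlib

open Set Filter Topology
open scoped ENNReal NNReal

/-! ### Lorentzian pre-length spaces -/

/-- A Lorentzian pre-length space structure on a metric space: a causal space with a lower
semicontinuous time separation function `tau` (the topology is the metric topology). -/
structure LorentzianPreLengthSpace (Y : Type*) [MetricSpace Y] where
  /-- the causal relation -/
  le : Y → Y → Prop
  /-- the chronological (timelike) relation -/
  ll : Y → Y → Prop
  /-- the time separation function -/
  tau : Y → Y → ℝ≥0∞
  separable : TopologicalSpace.SeparableSpace Y
  le_refl : ∀ x, le x x
  le_trans : ∀ x y z, le x y → le y z → le x z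
  ll_trans : ∀ x y z, ll x y → ll y z → ll x z
  le_of_ll : ∀ x y, ll x y → le x y
  lowerSemicontinuous_tau : LowerSemicontinuous fun p : Y × Y => tau p.1 p.2
  tau_eq_zero : ∀ x y, ¬ le x y → tau x y = 0
  tau_pos_iff : ∀ x y, 0 < tau x y ↔ ll x y
  reverse_triangle : ∀ x y z, le x y → le y z → tau x y + tau y z ≤ tau x z

namespace LorentzianPreLengthSpace

variable {Y : Type*} [MetricSpace Y] (L : LorentzianPreLengthSpace Y)

open Classical in
/-- The signed time separation function: `tau` on causal pairs and `-∞` on all other pairs. -/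
noncomputable def ell (x y : Y) : EReal :=
  if L.le x y then (L.tau x y : EReal) else ⊥

/-- Future directed causal curves on an interval `I`. -/
structure IsCausalCurve (γ : ℝ → Y) (I : Set ℝ) : Prop where
  interval : I.OrdConnected
  locallyLipschitz : LocallyLipschitzOn I γ
  causal : ∀ s ∈ I, ∀ t ∈ I, s ≤ t → L.le (γ s) (γ t)

/-- Past directed causal curves on an interval `I`. -/
structure IsPastCausalCurve (γ : ℝ → Y) (I : Set ℝ) : Prop where
  interval : I.OrdConnected
  locallyLipschitz : LocallyLipschitzOn I γ
  causal : ∀ s ∈ I, ∀ t ∈ I, s ≤ t → L.le (γ t) (γ s)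

/-- The `tau`-length of a curve on `[a, b]`: the infimum over all partitions
`a = t 0 < t 1 < ⋯ < t N = b` of `∑ i < N, tau (γ (t i)) (γ (t (i + 1)))`. -/
noncomputable def tauLength (γ : ℝ → Y) (a b : ℝ) : ℝ≥0∞ :=
  ⨅ (N : ℕ) (t : ℕ → ℝ) (_ : StrictMonoOn t (Set.Iic N)) (_ : t 0 = a) (_ : t N = b),
    ∑ i ∈ Finset.range N, L.tau (γ (t i)) (γ (t (i + 1)))

/-- Lorentzian geodesic spaces. The arclength with respect to the metric is `eVariationOn`. -/
structure IsGeodesic : Prop where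
  d_compatible : ∀ x : Y, ∃ U ∈ 𝓝 x, ∃ C : ℝ≥0, ∀ (γ : ℝ → Y) (I : Set ℝ),
    (L.IsCausalCurve γ I ∨ L.IsPastCausalCurve γ I) → MapsTo γ I U → eVariationOn γ I ≤ C
  geodesic : ∀ x y : Y, L.le x y → x ≠ y → ∃ (a b : ℝ) (γ : ℝ → Y), a < b ∧
    L.IsCausalCurve γ (Icc a b) ∧ γ a = x ∧ γ b = y ∧ L.tauLength γ a b = L.tau x y

/-- Proper covers `U 0 ⊆ U 1 ⊆ ⋯` of a Lorentzian pre-length space. -/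
structure IsProperCover (U : ℕ → Set Y) : Prop where
  iUnion_eq : ⋃ k, U k = univ
  subset_succ : ∀ k, U k ⊆ U (k + 1)
  relativelyCompact : ∀ k, IsCompact (closure (U k))
  tau_bounded : ∀ k, ∃ C : ℝ≥0, ∀ x ∈ U k, ∀ y ∈ U k, L.tau x y ≤ C

end LorentzianPreLengthSpace

/-! ### Two-dimensional Lorentzian model spaces

For `K > 0` the model space is the universal cover of the pseudosphere
`{-a² + b² + c² = 1}`, for `K = 0` it is the Minkowski plane, and for `K < 0` it is the universal
cover of the pseudohyperbolic space `{-a² - b² + c² = -1}`, with lengths scaled by `1 / √|K|`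
if `K ≠ 0`. All of them are described in global conformal coordinates `(t, x)`:
up to that scaling, the metric is `(-dt² + dx²) / cos² t` on `|t| < π / 2` if `K > 0`,
`-dt² + dx²` on the plane if `K = 0`, and `(-dt² + dx²) / cos² x` on `|x| < π / 2` if `K < 0`. -/

/-- Points of the model space of curvature `K`, in coordinates `(t, x)`. -/
def ModelSpace (K : ℝ) : Type :=
  {p : ℝ × ℝ // (0 < K → |p.1| < Real.pi / 2) ∧ (K < 0 → |p.2| < Real.pi / 2)}

namespace ModelSpace

variable {K : ℝ}

/-- The time coordinate. -/
def time (p : ModelSpace K) : ℝ := p.1.1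

/-- The space coordinate. -/
def pos (p : ModelSpace K) : ℝ := p.1.2

/-- The (covering) map to the unit pseudosphere, to the affine plane `{1} × ℝ²`, or to the unit
pseudohyperbolic space, all of them in `ℝ³`. -/
noncomputable def vec (p : ModelSpace K) : Fin 3 → ℝ :=
  if 0 < K then
    ![Real.tan p.time, Real.cos p.pos / Real.cos p.time, Real.sin p.pos / Real.cos p.time]
  else if K = 0 then
    ![1, p.time, p.pos]
  else
    ![Real.cos p.time / Real.cos p.pos, Real.sin p.time / Real.cos p.pos, Real.tan p.pos]

/-- The time separation function of the model space. Causality is read off from the conformal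
coordinates. If `q` is in the causal future of `p`, then, with the ambient bilinear forms,
* for `K > 0`: `cosh (√K * tau) = -a a' + b b' + c c'`;
* for `K = 0`: `tau = √((Δt)² - (Δx)²)`;
* for `K < 0`: `cos (√(-K) * tau) = a a' + b b' - c c'` as long as `Δt ≤ π - |x + x'|`, and beyond
  that there are causal curves from `p` to `q` of arbitrarily large length. -/
noncomputable def tau (p q : ModelSpace K) : ℝ≥0∞ :=
  if |q.pos - p.pos| ≤ q.time - p.time then
    if 0 < K then
      ENNReal.ofReal
        (Real.arcosh (-(p.vec 0 * q.vec 0) + p.vec 1 * q.vec 1 + p.vec 2 * q.vec 2) / √K)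
    else if K = 0 then
      ENNReal.ofReal √((q.time - p.time) ^ 2 - (q.pos - p.pos) ^ 2)
    else if q.time - p.time ≤ Real.pi - |p.pos + q.pos| then
      ENNReal.ofReal
        (Real.arccos (p.vec 0 * q.vec 0 + p.vec 1 * q.vec 1 - p.vec 2 * q.vec 2) / √(-K))
    else ⊤
  else 0

/-- The points `r` and `s` lie on opposite sides of the geodesic line through the timelike related
points `p` and `q`; points on the line itself belong to both sides. The line consists of points
whose image under `vec` is in the plane spanned by those of `p` and `q`, and the sign of the
determinant tells its two sides apart. (For `K > 0` this is meant for points `r` and `s` that are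
timelike related to `q`, where the other lifts of that plane play no role.) -/
def OppositeSides (p q r s : ModelSpace K) : Prop :=
  Matrix.det ![p.vec, q.vec, r.vec] * Matrix.det ![p.vec, q.vec, s.vec] ≤ 0

end ModelSpace

/-! ### Timelike sectional curvature bounds by the 4-point condition -/

/-- The timelike diameter of the model space of curvature `K`: it is `π / √(-K)` if `K < 0` and
infinite otherwise. -/
noncomputable def modelDiameter (K : ℝ) : ℝ≥0∞ :=
  if K < 0 then ENNReal.ofReal (Real.pi / √(-K)) else ⊤

namespace LorentzianPreLengthSpace

variable {Y : Type*} [MetricSpace Y] (L : LorentzianPreLengthSpace Y)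

/-- `(y', x', z₁', z₂')` is a comparison configuration for `(y, x, z₁, z₂)`, where
`y ≪ x ≪ z₁ ≤ z₂`. -/
structure IsFutureComparison (K : ℝ) (y x z₁ z₂ : Y) (y' x' z₁' z₂' : ModelSpace K) : Prop where
  tau_yx : L.tau y x = y'.tau x'
  tau_yz₁ : L.tau y z₁ = y'.tau z₁'
  tau_yz₂ : L.tau y z₂ = y'.tau z₂'
  tau_xz₁ : L.tau x z₁ = x'.tau z₁'
  tau_xz₂ : L.tau x z₂ = x'.tau z₂'
  opposite : ModelSpace.OppositeSides y' x' z₁' z₂'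

/-- `(z₂', z₁', x', y')` is a comparison configuration for `(z₂, z₁, x, y)`, where
`z₂ ≤ z₁ ≪ x ≪ y`. -/
structure IsPastComparison (K : ℝ) (z₂ z₁ x y : Y) (z₂' z₁' x' y' : ModelSpace K) : Prop where
  tau_xy : L.tau x y = x'.tau y'
  tau_z₁y : L.tau z₁ y = z₁'.tau y'
  tau_z₂y : L.tau z₂ y = z₂'.tau y'
  tau_z₁x : L.tau z₁ x = z₁'.tau x'
  tau_z₂x : L.tau z₂ x = z₂'.tau x'
  opposite : ModelSpace.OppositeSides y' x' z₁' z₂'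

/-- `≥ K`-comparison neighborhoods. -/
structure IsComparisonNeighborhood (K : ℝ) (U : Set Y) : Prop where
  isOpen : IsOpen U
  isOpen_domain : IsOpen ((U ×ˢ U) ∩ {p : Y × Y | L.tau p.1 p.2 < modelDiameter K})
  continuousOn_tau : ContinuousOn (fun p : Y × Y => L.tau p.1 p.2)
    ((U ×ˢ U) ∩ {p : Y × Y | L.tau p.1 p.2 < modelDiameter K})
  future : ∀ y ∈ U, ∀ x ∈ U, ∀ z₁ ∈ U, ∀ z₂ ∈ U,
    L.ll y x → L.ll x z₁ → L.le z₁ z₂ → L.tau y z₂ < modelDiameter K →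
    ∀ y' x' z₁' z₂' : ModelSpace K, L.IsFutureComparison K y x z₁ z₂ y' x' z₁' z₂' →
      z₁'.tau z₂' ≤ L.tau z₁ z₂
  past : ∀ z₂ ∈ U, ∀ z₁ ∈ U, ∀ x ∈ U, ∀ y ∈ U,
    L.le z₂ z₁ → L.ll z₁ x → L.ll x y → L.tau z₂ y < modelDiameter K →
    ∀ z₂' z₁' x' y' : ModelSpace K, L.IsPastComparison K z₂ z₁ x y z₂' z₁' x' y' →
      z₂'.tau z₁' ≤ L.tau z₂ z₁

/-- Timelike sectional curvature bounded below by `K`. -/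
def HasTimelikeCurvatureGE (K : ℝ) : Prop :=
  ∀ x : Y, ∃ U : Set Y, x ∈ U ∧ L.IsComparisonNeighborhood K U

/-- Global timelike sectional curvature bounded below by `K`. -/
def HasGlobalTimelikeCurvatureGE (K : ℝ) : Prop :=
  L.IsComparisonNeighborhood K univ

end LorentzianPreLengthSpace

/-! ### Convergence -/

/-- `φ` restricts to a `δ`-Gromov-Hausdorff isometry from `A` to `B`. -/
structure IsGHIsometryOn {X Z : Type*} [MetricSpace X] [MetricSpace Z] (δ : ℝ) (φ : X → Z)
    (A : Set X) (B : Set Z) : Prop where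
  mapsTo : MapsTo φ A B
  distortion : ∀ x ∈ A, ∀ y ∈ A, |dist (φ x) (φ y) - dist x y| < δ
  dense : ∀ z ∈ B, ∃ x ∈ A, dist (φ x) z < δ

section Convergence

variable {Y : ℕ → Type*} [∀ i, MetricSpace (Y i)] {Z : Type*} [MetricSpace Z]

/-- The maps `φ k i` realize the convergence in covered Gromov-Hausdorff sense: for each `k`, the
closures of the sets `U i k` converge to the closure of `V k` as `i → ∞`, through
`δ`-Gromov-Hausdorff isometries `φ k i` with `δ → 0`. -/
def RealizesCoveredGHConvergence (U : ∀ i, ℕ → Set (Y i)) (V : ℕ → Set Z)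
    (φ : ∀ (_ : ℕ) (i : ℕ), Y i → Z) : Prop :=
  ∀ k : ℕ, ∀ δ > 0, ∀ᶠ i in atTop, IsGHIsometryOn δ (φ k i) (closure (U i k)) (closure (V k))

/-- A sequence of covered Lorentzian pre-length spaces is uniformly non-totally imprisoning. -/
def UniformlyNonTotallyImprisoning (L : ∀ i, LorentzianPreLengthSpace (Y i))
    (U : ∀ i, ℕ → Set (Y i)) : Prop :=
  ∀ k : ℕ, ∃ C : ℝ≥0, ∀ (i : ℕ) (γ : ℝ → Y i) (I : Set ℝ),
    (L i).IsCausalCurve γ I → MapsTo γ I (U i k) → eVariationOn γ I ≤ C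

/-- Uniform convergence of the signed time separation functions along the approximations `φ`.
In the upper bound the comparison is with `max (ell x y) 0`, because `(x, y)` need not be a causal
pair, even if it is arbitrarily close to one. -/
def SignedTimeSeparationConverges (L : ∀ i, LorentzianPreLengthSpace (Y i))
    (U : ∀ i, ℕ → Set (Y i)) (M : LorentzianPreLengthSpace Z) (V : ℕ → Set Z)
    (φ : ∀ (_ : ℕ) (i : ℕ), Y i → Z) : Prop :=
  ∀ k l : ℕ, 0 < l → ∀ ε : ℝ, 0 < ε → ε < 1 / (2 * l) → ∃ δ > 0, ∃ i₀ : ℕ, ∀ i ≥ i₀,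
    ∀ xi ∈ closure (U i k), ∀ yi ∈ closure (U i k),
    ∀ x ∈ closure (V k), ∀ y ∈ closure (V k),
    dist (φ k i xi) x + dist (φ k i yi) y ≤ δ →
      (0 ≤ (L i).ell xi yi → (L i).ell xi yi ≤ max (M.ell x y) 0 + (ε : EReal)) ∧
      (((1 / l : ℝ) : EReal) ≤ M.ell x y → M.ell x y - (ε : EReal) ≤ (L i).ell xi yi)

/-- `ℓ`-convergence of covered Lorentzian pre-length spaces. -/
def EllConverges (L : ∀ i, LorentzianPreLengthSpace (Y i)) (U : ∀ i, ℕ → Set (Y i))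
    (M : LorentzianPreLengthSpace Z) (V : ℕ → Set Z) : Prop :=
  UniformlyNonTotallyImprisoning L U ∧
  ∃ φ : ∀ (_ : ℕ) (i : ℕ), Y i → Z,
    RealizesCoveredGHConvergence U V φ ∧ SignedTimeSeparationConverges L U M V φ

end Convergence

/-! The four-point inequality is passed to the limit, and the case where `z₁` and `z₂` are only null
related is reduced to the case `z₁ ≪ z₂`.

By `ℓ`-convergence, any four points of the limit are matched by four points of some `Y i` with all
chronological relations kept and the positive time separations nearly kept
(`approximable_of_ellConverges`). Let `z₁ ≪ z₂`, and suppose that the comparison points of `z₁`,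
`z₂` have too large a time separation. Hinges in the model space can be perturbed along with their
side lengths (`HingeData.exists_near`), so a comparison hinge of the matching quadruple also has end
points with too large a time separation, against the curvature bound of `Y i`
(`tau_le_of_approximable`).

If `τ(z₁, z₂) = 0` this fails, because the points matching a null pair need not be causally related.
Suppose that the comparison points of `z₁`, `z₂` are nevertheless timelike related. On a maximizing
curve from `x` to `z₁`, let `w` be the first point with `τ(w, z₂) = 0`. Then `τ(w, z₁) = 0`, hence
`τ(x, w) = τ(x, z₁)`, while `τ(y, w) ≤ τ(y, z₁)`. So the hinge for `w` differs from the given one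
only by a shorter side `c₁`. This closes its angle, and the end points stay timelike related
(`HingeData.exists_slide`). Points just before `w` lie in the timelike past of `z₂`; their time
separation to `z₂` tends to `0` by continuity (`continuous_tau_of_ellConverges`), but that of their
comparison points stays away from `0`. This contradicts the first case. The past condition follows
by time reversal.

In the model space everything is computed in `ℝ³`. There `sep` is polynomial in the ambient
coordinates, and the square of the signed area `side` is the polynomial `heron` in the three values
of `sep`. -/

namespace ModelSpace

variable {K : ℝ}

/-! ### Model space: ambient coordinates and chord lengths -/

instance : TopologicalSpace (ModelSpace K) := instTopologicalSpaceSubtype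

lemma continuous_time : Continuous (time : ModelSpace K → ℝ) :=
  continuous_fst.comp continuous_subtype_val

lemma continuous_pos : Continuous (pos : ModelSpace K → ℝ) :=
  continuous_snd.comp continuous_subtype_val

lemma cos_time_pos (hK : 0 < K) (p : ModelSpace K) : 0 < Real.cos p.time :=
  Real.cos_pos_of_mem_Ioo (abs_lt.1 (p.2.1 hK))

lemma cos_pos_pos (hK : K < 0) (p : ModelSpace K) : 0 < Real.cos p.pos :=
  Real.cos_pos_of_mem_Ioo (abs_lt.1 (p.2.2 hK))

lemma abs_time_lt (hK : 0 < K) (p : ModelSpace K) : |p.time| < Real.pi / 2 := p.2.1 hK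

lemma abs_pos_lt (hK : K < 0) (p : ModelSpace K) : |p.pos| < Real.pi / 2 := p.2.2 hK

lemma vec_of_pos (hK : 0 < K) (p : ModelSpace K) : p.vec =
    ![Real.tan p.time, Real.cos p.pos / Real.cos p.time, Real.sin p.pos / Real.cos p.time] := by
  simp [vec, hK]

lemma vec_of_zero (hK : K = 0) (p : ModelSpace K) : p.vec = ![1, p.time, p.pos] := by
  simp [vec, hK]

lemma vec_of_neg (hK : K < 0) (p : ModelSpace K) : p.vec =
    ![Real.cos p.time / Real.cos p.pos, Real.sin p.time / Real.cos p.pos, Real.tan p.pos] := by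
  simp [vec, hK.not_gt, hK.ne]

lemma continuous_vec : Continuous (vec : ModelSpace K → Fin 3 → ℝ) := by
  have ht := continuous_time (K := K)
  have hx := continuous_pos (K := K)
  rcases lt_trichotomy K 0 with hK | hK | hK
  · have h := fun p : ModelSpace K => (cos_pos_pos hK p).ne'
    rw [funext (vec_of_neg hK)]
    refine continuous_pi fun i => ?_
    fin_cases i
    · exact (Real.continuous_cos.comp ht).div (Real.continuous_cos.comp hx) h
    · exact (Real.continuous_sin.comp ht).div (Real.continuous_cos.comp hx) h
    · simp only [Real.tan_eq_sin_div_cos]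
      exact (Real.continuous_sin.comp hx).div (Real.continuous_cos.comp hx) h
  · rw [funext (vec_of_zero hK)]
    refine continuous_pi fun i => ?_
    fin_cases i
    · exact continuous_const
    · exact ht
    · exact hx
  · have h := fun p : ModelSpace K => (cos_time_pos hK p).ne'
    rw [funext (vec_of_pos hK)]
    refine continuous_pi fun i => ?_
    fin_cases i
    · simp only [Real.tan_eq_sin_div_cos]
      exact (Real.continuous_sin.comp ht).div (Real.continuous_cos.comp ht) h
    · exact (Real.continuous_cos.comp hx).div (Real.continuous_cos.comp ht) h
    · exact (Real.continuous_sin.comp hx).div (Real.continuous_cos.comp ht) h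

/-- The ambient bilinear form (degenerate if `K = 0`). -/
noncomputable def form (K : ℝ) (v w : Fin 3 → ℝ) : ℝ :=
  if 0 < K then -(v 0 * w 0) + v 1 * w 1 + v 2 * w 2
  else if K = 0 then v 0 * w 0
  else v 0 * w 0 + v 1 * w 1 - v 2 * w 2

lemma form_of_pos (hK : 0 < K) (v w : Fin 3 → ℝ) :
    form K v w = -(v 0 * w 0) + v 1 * w 1 + v 2 * w 2 := by simp [form, hK]

lemma form_of_zero (hK : K = 0) (v w : Fin 3 → ℝ) : form K v w = v 0 * w 0 := by
  simp [form, hK]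

lemma form_of_neg (hK : K < 0) (v w : Fin 3 → ℝ) :
    form K v w = v 0 * w 0 + v 1 * w 1 - v 2 * w 2 := by simp [form, hK.not_gt, hK.ne]

lemma form_vec_self (p : ModelSpace K) : form K p.vec p.vec = 1 := by
  rcases lt_trichotomy K 0 with hK | hK | hK
  · have h := (cos_pos_pos hK p).ne'
    rw [form_of_neg hK, vec_of_neg hK]
    simp only [Matrix.cons_val, Real.tan_eq_sin_div_cos]
    field_simp
    nlinarith [Real.sin_sq_add_cos_sq p.time, Real.sin_sq_add_cos_sq p.pos]
  · rw [form_of_zero hK, vec_of_zero hK]; simp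
  · have h := (cos_time_pos hK p).ne'
    rw [form_of_pos hK, vec_of_pos hK]
    simp only [Matrix.cons_val, Real.tan_eq_sin_div_cos]
    field_simp
    nlinarith [Real.sin_sq_add_cos_sq p.time, Real.sin_sq_add_cos_sq p.pos]

/-- Half the squared chord length between two points of the ambient space. For a causal pair it
is a strictly increasing function of the time separation. -/
noncomputable def vsep (K : ℝ) (v w : Fin 3 → ℝ) : ℝ :=
  if 0 < K then form K v w - 1
  else if K = 0 then ((w 1 - v 1) ^ 2 - (w 2 - v 2) ^ 2) / 2
  else 1 - form K v w

noncomputable def sep (p q : ModelSpace K) : ℝ := vsep K p.vec q.vec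

lemma vsep_of_pos (hK : 0 < K) (v w : Fin 3 → ℝ) :
    vsep K v w = -(v 0 * w 0) + v 1 * w 1 + v 2 * w 2 - 1 := by simp [vsep, form, hK]

lemma vsep_of_zero (hK : K = 0) (v w : Fin 3 → ℝ) :
    vsep K v w = ((w 1 - v 1) ^ 2 - (w 2 - v 2) ^ 2) / 2 := by simp [vsep, hK]

lemma vsep_of_neg (hK : K < 0) (v w : Fin 3 → ℝ) :
    vsep K v w = 1 - (v 0 * w 0 + v 1 * w 1 - v 2 * w 2) := by
  simp [vsep, form, hK.not_gt, hK.ne]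

lemma continuous_vsep : Continuous fun x : (Fin 3 → ℝ) × (Fin 3 → ℝ) => vsep K x.1 x.2 := by
  rcases lt_trichotomy K 0 with hK | hK | hK
  · simp only [vsep_of_neg hK]; fun_prop
  · simp only [vsep_of_zero hK]; fun_prop
  · simp only [vsep_of_pos hK]; fun_prop

lemma continuous_sep : Continuous fun x : ModelSpace K × ModelSpace K => sep x.1 x.2 :=
  continuous_vsep.comp
    ((continuous_vec.comp continuous_fst).prodMk (continuous_vec.comp continuous_snd))

lemma sep_of_pos (hK : 0 < K) (p q : ModelSpace K) : sep p q =
    (Real.cos (q.pos - p.pos) - Real.cos (q.time - p.time)) /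
      (Real.cos p.time * Real.cos q.time) := by
  have hp := (cos_time_pos hK p).ne'
  have hq := (cos_time_pos hK q).ne'
  rw [sep, vsep_of_pos hK, vec_of_pos hK, vec_of_pos hK, Real.cos_sub, Real.cos_sub]
  simp only [Matrix.cons_val, Real.tan_eq_sin_div_cos]
  field_simp
  ring

lemma sep_of_zero (hK : K = 0) (p q : ModelSpace K) : sep p q =
    ((q.time - p.time) ^ 2 - (q.pos - p.pos) ^ 2) / 2 := by
  rw [sep, vsep_of_zero hK, vec_of_zero hK, vec_of_zero hK]
  simp

lemma sep_of_neg (hK : K < 0) (p q : ModelSpace K) : sep p q =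
    (Real.cos (q.pos - p.pos) - Real.cos (q.time - p.time)) /
      (Real.cos p.pos * Real.cos q.pos) := by
  have hp := (cos_pos_pos hK p).ne'
  have hq := (cos_pos_pos hK q).ne'
  rw [sep, vsep_of_neg hK, vec_of_neg hK, vec_of_neg hK, Real.cos_sub, Real.cos_sub]
  simp only [Matrix.cons_val, Real.tan_eq_sin_div_cos]
  field_simp
  ring

/-! ### Model space: causality and the sign of `sep` -/

/-- Timelike related points with finite time separation. -/
def Chron (p q : ModelSpace K) : Prop :=
  |q.pos - p.pos| < q.time - p.time ∧
    (K < 0 → q.time - p.time < Real.pi - |p.pos + q.pos|)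

/-- The causal relation. -/
def Caus (p q : ModelSpace K) : Prop := |q.pos - p.pos| ≤ q.time - p.time

lemma Chron.caus {p q : ModelSpace K} (h : Chron p q) : Caus p q := h.1.le

lemma Caus.trans {p q r : ModelSpace K} (h : Caus p q) (h' : Caus q r) : Caus p r := by
  simp only [Caus, abs_le] at *
  constructor <;> linarith [h.1, h.2, h'.1, h'.2]

lemma isOpen_chron : IsOpen {x : ModelSpace K × ModelSpace K | Chron x.1 x.2} := by
  have h1 := (continuous_time (K := K)).comp continuous_fst (X := ModelSpace K × ModelSpace K)
  have h2 := (continuous_time (K := K)).comp continuous_snd (X := ModelSpace K × ModelSpace K)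
  have h3 := (continuous_pos (K := K)).comp continuous_fst (X := ModelSpace K × ModelSpace K)
  have h4 := (continuous_pos (K := K)).comp continuous_snd (X := ModelSpace K × ModelSpace K)
  simp only [Function.comp_def] at h1 h2 h3 h4
  refine (isOpen_lt (h4.sub h3).abs (h2.sub h1)).inter ?_
  by_cases hK : K < 0
  · simp only [hK, forall_const]
    exact isOpen_lt (h2.sub h1) (continuous_const.sub (h3.add h4).abs)
  · simp only [hK, IsEmpty.forall_iff]
    exact isOpen_univ

lemma cos_lt_cos_of_abs_lt {s t : ℝ} (h : |s| < t) (ht : t ≤ Real.pi) :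
    Real.cos t < Real.cos s := by
  rw [← Real.cos_abs s]
  exact Real.cos_lt_cos_of_nonneg_of_le_pi (abs_nonneg s) ht h

lemma Chron.sep_pos {p q : ModelSpace K} (h : Chron p q) : 0 < sep p q := by
  obtain ⟨h1, h2⟩ := h
  rcases lt_trichotomy K 0 with hK | hK | hK
  · rw [sep_of_neg hK]
    have := h2 hK
    have := abs_nonneg (p.pos + q.pos)
    exact div_pos (sub_pos.2 (cos_lt_cos_of_abs_lt h1 (by linarith)))
      (mul_pos (cos_pos_pos hK p) (cos_pos_pos hK q))
  · rw [sep_of_zero hK]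
    have := abs_lt.1 h1
    nlinarith
  · rw [sep_of_pos hK]
    have := abs_lt.1 (abs_time_lt hK p)
    have := abs_lt.1 (abs_time_lt hK q)
    exact div_pos (sub_pos.2 (cos_lt_cos_of_abs_lt h1 (by linarith)))
      (mul_pos (cos_time_pos hK p) (cos_time_pos hK q))

lemma sep_of_null {p q : ModelSpace K} (h : |q.pos - p.pos| = q.time - p.time) :
    sep p q = 0 := by
  have hc : Real.cos (q.pos - p.pos) = Real.cos (q.time - p.time) := by rw [← h, Real.cos_abs]
  rcases lt_trichotomy K 0 with hK | hK | hK
  · simp [sep_of_neg hK, hc]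
  · simp [sep_of_zero hK, ← h, sq_abs]
  · simp [sep_of_pos hK, hc]

lemma sep_self (p : ModelSpace K) : sep p p = 0 := sep_of_null (by simp)

/-- For `K < 0`, `2 - sep p q` is the chord quantity between the antipode of `p` and `q`. Its
product form detects the border `Δt = π - |x + x'|`, just as that of `sep` detects the light cone.
-/
lemma two_sub_sep (hK : K < 0) (p q : ModelSpace K) : 2 - sep p q =
    (Real.cos (p.pos + q.pos) + Real.cos (q.time - p.time)) /
      (Real.cos p.pos * Real.cos q.pos) := by
  have hp := (cos_pos_pos hK p).ne'
  have hq := (cos_pos_pos hK q).ne'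
  rw [sep_of_neg hK, Real.cos_sub, Real.cos_add]
  field_simp
  ring

lemma Chron.sep_lt_two {p q : ModelSpace K} (h : Chron p q) (hK : K < 0) : sep p q < 2 := by
  rw [← sub_pos, two_sub_sep hK]
  refine div_pos ?_ (mul_pos (cos_pos_pos hK p) (cos_pos_pos hK q))
  have h1 := cos_lt_cos_of_abs_lt (s := p.pos + q.pos) (t := Real.pi - (q.time - p.time))
    (by linarith [h.2 hK]) (by linarith [h.1, abs_nonneg (q.pos - p.pos)])
  rw [Real.cos_pi_sub] at h1
  linarith

lemma sep_eq_two (hK : K < 0) {p q : ModelSpace K}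
    (h : q.time - p.time = Real.pi - |p.pos + q.pos|) : sep p q = 2 := by
  have : 2 - sep p q = 0 := by
    rw [two_sub_sep hK, h, Real.cos_pi_sub, Real.cos_abs]; simp
  linarith

/-! ### Model space: time separation versus `sep` -/

/-- The time separation as a function of `sep`. -/
noncomputable def tauOfSep (K s : ℝ) : ℝ :=
  if 0 < K then Real.arcosh (1 + s) / √K
  else if K = 0 then √(2 * s)
  else Real.arccos (1 - s) / √(-K)

/-- The value of `sep` as a function of the time separation. -/
noncomputable def sepOfTau (K r : ℝ) : ℝ :=
  if 0 < K then Real.cosh (√K * r) - 1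
  else if K = 0 then r ^ 2 / 2
  else 1 - Real.cos (√(-K) * r)

lemma tau_of_caus {p q : ModelSpace K} (h : Caus p q)
    (h' : K < 0 → q.time - p.time ≤ Real.pi - |p.pos + q.pos|) :
    tau p q = ENNReal.ofReal (tauOfSep K (sep p q)) := by
  rw [tau, if_pos (show |q.pos - p.pos| ≤ _ from h), tauOfSep]
  rcases lt_trichotomy K 0 with hK | hK | hK
  · rw [if_neg hK.not_gt, if_neg hK.ne, if_pos (h' hK), if_neg hK.not_gt, if_neg hK.ne, sep,
      vsep_of_neg hK, sub_sub_cancel]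
  · rw [if_neg hK.not_gt, if_pos hK, if_neg hK.not_gt, if_pos hK, sep_of_zero hK,
      mul_div_cancel₀ _ two_ne_zero]
  · rw [if_pos hK, if_pos hK, sep, vsep_of_pos hK, add_sub_cancel]

lemma tauOfSep_zero : tauOfSep K 0 = 0 := by
  simp [tauOfSep]

lemma tauOfSep_pos {s : ℝ} (hs : 0 < s) : 0 < tauOfSep K s := by
  rw [tauOfSep]
  split_ifs with h1 h2
  · exact div_pos (Real.arcosh_pos (by linarith)) (Real.sqrt_pos.2 h1)
  · positivity
  · have : K < 0 := lt_of_le_of_ne (not_lt.1 h1) h2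
    exact div_pos (Real.arccos_pos.2 (by linarith)) (Real.sqrt_pos.2 (by linarith))

lemma continuousAt_tauOfSep {s : ℝ} (hs : 0 < s) : ContinuousAt (tauOfSep K) s := by
  unfold tauOfSep
  by_cases h1 : 0 < K
  · simp only [h1, if_true]
    have : ContinuousAt Real.arcosh (1 + s) :=
      (Real.continuousOn_arcosh).continuousAt (Ici_mem_nhds (by linarith))
    exact (ContinuousAt.comp (f := fun s : ℝ => 1 + s) this (by fun_prop)).div_const _
  · by_cases h2 : K = 0
    · simp only [h2, if_true]; simp only [lt_irrefl, if_false]; fun_prop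
    · simp only [h1, h2, if_false]
      exact ((Real.continuous_arccos.comp (continuous_const.sub continuous_id)).div_const
        _).continuousAt

lemma continuous_sepOfTau : Continuous (sepOfTau K) := by
  unfold sepOfTau
  by_cases h1 : 0 < K
  · simp only [h1, if_true]; fun_prop
  · by_cases h2 : K = 0
    · simp only [h2, if_true]; simp only [lt_irrefl, if_false]; fun_prop
    · simp only [h1, h2, if_false]; fun_prop

lemma sepOfTau_tauOfSep {s : ℝ} (hs : 0 < s) (hs' : K < 0 → s ≤ 2) :
    sepOfTau K (tauOfSep K s) = s := by
  rw [sepOfTau, tauOfSep]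
  split_ifs with h1 h2
  · rw [mul_div_cancel₀ _ (Real.sqrt_pos.2 h1).ne', Real.cosh_arcosh (by linarith)]; ring
  · rw [Real.sq_sqrt (by linarith)]; ring
  · have hK : K < 0 := lt_of_le_of_ne (not_lt.1 h1) h2
    have := hs' hK
    rw [mul_div_cancel₀ _ (Real.sqrt_pos.2 (by linarith)).ne',
      Real.cos_arccos (by linarith) (by linarith)]
    ring

lemma sqrt_neg_mul_lt_pi (hK : K < 0) {r : ℝ} (h : ENNReal.ofReal r < modelDiameter K) :
    √(-K) * r < Real.pi := by
  have h0 : 0 < √(-K) := Real.sqrt_pos.2 (by linarith)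
  rw [modelDiameter, if_pos hK, ENNReal.ofReal_lt_ofReal_iff (by positivity), lt_div_iff₀ h0] at h
  linarith

lemma tauOfSep_sepOfTau {r : ℝ} (hr : 0 < r) (h : ENNReal.ofReal r < modelDiameter K) :
    tauOfSep K (sepOfTau K r) = r := by
  rw [sepOfTau, tauOfSep]
  split_ifs with h1 h2
  · have := Real.sqrt_pos.2 h1
    rw [add_sub_cancel, Real.arcosh_cosh (by positivity), mul_div_cancel_left₀ _ this.ne']
  · rw [mul_div_cancel₀ _ two_ne_zero, Real.sqrt_sq hr.le]
  · have hK : K < 0 := lt_of_le_of_ne (not_lt.1 h1) h2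
    have := Real.sqrt_pos.2 (neg_pos.2 hK)
    rw [sub_sub_cancel, Real.arccos_cos (by positivity) (sqrt_neg_mul_lt_pi hK h).le,
      mul_div_cancel_left₀ _ this.ne']

lemma Chron.tau_eq {p q : ModelSpace K} (h : Chron p q) :
    tau p q = ENNReal.ofReal (tauOfSep K (sep p q)) :=
  tau_of_caus h.caus fun hK => (h.2 hK).le

lemma Chron.tau_pos {p q : ModelSpace K} (h : Chron p q) : 0 < tau p q := by
  rw [h.tau_eq]
  exact ENNReal.ofReal_pos.2 (tauOfSep_pos h.sep_pos)

/-- Prescribing a time separation strictly between `0` and the diameter amounts to an open condition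
and an equation for `sep`. The border cases drop out: null pairs have `τ = 0`, and pairs with `Δt =
π - |x + x'|` have `sep = 2`, that is, `τ` equal to the diameter. -/
lemma tau_eq_ofReal_iff {p q : ModelSpace K} {r : ℝ} (hr : 0 < r)
    (h : ENNReal.ofReal r < modelDiameter K) :
    tau p q = ENNReal.ofReal r ↔ Chron p q ∧ sep p q = sepOfTau K r := by
  constructor
  · intro e
    have hc : Caus p q := by
      by_contra hc
      rw [tau, if_neg (show ¬ |q.pos - p.pos| ≤ _ from hc)] at e
      exact (ENNReal.ofReal_pos.2 hr).ne e
    have hb : K < 0 → q.time - p.time ≤ Real.pi - |p.pos + q.pos| := by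
      intro hK
      by_contra hb
      rw [tau, if_pos (show |q.pos - p.pos| ≤ _ from hc), if_neg hK.not_gt, if_neg hK.ne, if_neg hb] at e
      exact ENNReal.ofReal_ne_top e.symm
    have e' := e
    rw [tau_of_caus hc hb] at e'
    have h1 : |q.pos - p.pos| < q.time - p.time := by
      refine lt_of_le_of_ne hc fun h1 => ?_
      rw [sep_of_null h1, tauOfSep_zero] at e'
      simp only [ENNReal.ofReal_zero] at e'
      exact (ENNReal.ofReal_pos.2 hr).ne e'
    have h2 : K < 0 → q.time - p.time < Real.pi - |p.pos + q.pos| := by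
      refine fun hK => lt_of_le_of_ne (hb hK) fun h2 => ?_
      rw [sep_eq_two hK h2, tauOfSep, if_neg hK.not_gt, if_neg hK.ne] at e'
      norm_num at e'
      rw [modelDiameter, if_pos hK, ← e'] at h
      exact lt_irrefl _ h
    have hch : Chron p q := ⟨h1, h2⟩
    refine ⟨hch, ?_⟩
    rw [ENNReal.ofReal_eq_ofReal_iff (tauOfSep_pos hch.sep_pos).le hr.le] at e'
    rw [← e', sepOfTau_tauOfSep hch.sep_pos fun hK => (hch.sep_lt_two hK).le]
  · rintro ⟨hc, e⟩
    rw [hc.tau_eq, e, tauOfSep_sepOfTau hr h]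

lemma Chron.continuousAt_tau {p q : ModelSpace K} (h : Chron p q) :
    ContinuousAt (fun x : ModelSpace K × ModelSpace K => tau x.1 x.2) (p, q) := by
  have h1 : (fun x : ModelSpace K × ModelSpace K => tau x.1 x.2) =ᶠ[𝓝 (p, q)]
      fun x => ENNReal.ofReal (tauOfSep K (sep x.1 x.2)) := by
    filter_upwards [isOpen_chron.mem_nhds h] with x hx using Chron.tau_eq hx
  have h2 : Tendsto (fun x : ModelSpace K × ModelSpace K => sep x.1 x.2) (𝓝 (p, q))
      (𝓝 (sep p q)) := continuous_sep.tendsto (p, q)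
  have h3 := ENNReal.tendsto_ofReal ((continuousAt_tauOfSep (K := K) h.sep_pos).tendsto.comp h2)
  rw [← h.tau_eq] at h3
  exact h3.congr' h1.symm

/-- Causal pairs inside the causal diamond of a `Chron` pair. -/
lemma Chron.bound {p q r s : ModelSpace K} (h : Chron p s) (h1 : Caus p q)
    (h3 : Caus r s) (hK : K < 0) : r.time - q.time < Real.pi - |q.pos + r.pos| := by
  have := h.2 hK
  simp only [Caus] at *
  have e : q.pos + r.pos = (p.pos + s.pos) + (q.pos - p.pos) - (s.pos - r.pos) := by ring
  have := abs_sub (p.pos + s.pos + (q.pos - p.pos)) (s.pos - r.pos)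
  have := abs_add_le (p.pos + s.pos) (q.pos - p.pos)
  rw [e]
  linarith

lemma Caus.chron_of_sep_ne_zero {p q : ModelSpace K} (h : Caus p q) (h0 : sep p q ≠ 0)
    (hb : K < 0 → q.time - p.time < Real.pi - |p.pos + q.pos|) : Chron p q :=
  ⟨lt_of_le_of_ne h fun e => h0 (sep_of_null e), hb⟩

/-! ### Triangles in the ambient space: Gram determinants and third vertices -/

/-- The equation of the image of `vec`. -/
def OnModel (K : ℝ) (v : Fin 3 → ℝ) : Prop := if K = 0 then v 0 = 1 else form K v v = 1

lemma onModel_of_zero (hK : K = 0) {v : Fin 3 → ℝ} : OnModel K v ↔ v 0 = 1 := by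
  simp [OnModel, hK]

lemma onModel_of_pos (hK : 0 < K) {v : Fin 3 → ℝ} :
    OnModel K v ↔ -(v 0 * v 0) + v 1 * v 1 + v 2 * v 2 = 1 := by
  simp [OnModel, hK.ne', form_of_pos hK]

lemma onModel_of_neg (hK : K < 0) {v : Fin 3 → ℝ} :
    OnModel K v ↔ v 0 * v 0 + v 1 * v 1 - v 2 * v 2 = 1 := by
  simp [OnModel, hK.ne, form_of_neg hK]

lemma onModel_vec (p : ModelSpace K) : OnModel K p.vec := by
  rw [OnModel]
  split_ifs with h
  · simp [vec_of_zero h]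
  · exact form_vec_self p

/-- The determinant that tells the two sides of a line apart. -/
def vdet (u v w : Fin 3 → ℝ) : ℝ :=
  (u 1 * v 2 - u 2 * v 1) * w 0 + (u 2 * v 0 - u 0 * v 2) * w 1 + (u 0 * v 1 - u 1 * v 0) * w 2

lemma det_eq_vdet (u v w : Fin 3 → ℝ) : Matrix.det ![u, v, w] = vdet u v w := by
  refine (Matrix.det_fin_three (Matrix.of ![u, v, w])).trans ?_
  simp [vdet]
  ring

lemma continuous_vdet :
    Continuous fun x : (Fin 3 → ℝ) × (Fin 3 → ℝ) × (Fin 3 → ℝ) => vdet x.1 x.2.1 x.2.2 := by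
  simp only [vdet]; fun_prop

/-- The signed area of a triangle in the model space. -/
noncomputable def side (p q r : ModelSpace K) : ℝ := vdet p.vec q.vec r.vec

lemma continuous_side :
    Continuous fun x : ModelSpace K × ModelSpace K × ModelSpace K => side x.1 x.2.1 x.2.2 := by
  have h : Continuous fun x : ModelSpace K × ModelSpace K × ModelSpace K =>
      (x.1.vec, x.2.1.vec, x.2.2.vec) :=
    (continuous_vec.comp continuous_fst).prodMk
      ((continuous_vec.comp (continuous_fst.comp continuous_snd)).prodMk
        (continuous_vec.comp (continuous_snd.comp continuous_snd)))
  exact continuous_vdet.comp h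

lemma oppositeSides_iff {p q r s : ModelSpace K} :
    OppositeSides p q r s ↔ side p q r * side p q s ≤ 0 := by
  rw [OppositeSides, det_eq_vdet, det_eq_vdet, side, side]

/-- The Gram determinant of a triangle in terms of the values of `sep`; `e` is the sign of the
curvature. -/
def heron (e a b c : ℝ) : ℝ :=
  a ^ 2 + b ^ 2 + c ^ 2 - 2 * (a * b + b * c + c * a) - 2 * e * a * b * c

/-- For `K ≠ 0` the ambient form has determinant `-1`, so the product of the two determinants is
minus the mixed Gram determinant of `u, v, w` and `u, v, z`; then `form = 1 ± vsep` is inserted. For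
`K = 0` the form is degenerate, and the identity is checked in coordinates. -/
lemma vdet_mul_vdet {u v : Fin 3 → ℝ} (hu : OnModel K u) (hv : OnModel K v)
    {w z : Fin 3 → ℝ} (hw : OnModel K w) (hz : OnModel K z) :
    vdet u v w * vdet u v z =
      vsep K u v * (2 + K.sign * vsep K u v) * vsep K w z
      + (vsep K u w - vsep K v w) * (vsep K u z - vsep K v z)
      - vsep K u v * (vsep K v w + vsep K v z + vsep K u w + vsep K u z) + vsep K u v ^ 2
      - K.sign * vsep K u v * (vsep K v w * vsep K u z + vsep K v z * vsep K u w) := by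
  have gram : ∀ (e A uw uz vw vz wz : ℝ), (e = 1 ∨ e = -1) →
      -(wz - vz * vw - A * (A * wz - vz * uw) + uz * (A * vw - uw)) =
      (e * (A - 1)) * (2 + e * (e * (A - 1))) * (e * (wz - 1))
      + (e * (uw - 1) - e * (vw - 1)) * (e * (uz - 1) - e * (vz - 1))
      - (e * (A - 1)) * (e * (vw - 1) + e * (vz - 1) + e * (uw - 1) + e * (uz - 1))
      + (e * (A - 1)) ^ 2
      - e * (e * (A - 1)) * ((e * (vw - 1)) * (e * (uz - 1)) + (e * (vz - 1)) * (e * (uw - 1))) := by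
    rintro e A uw uz vw vz wz (rfl | rfl) <;> ring
  rcases lt_trichotomy K 0 with hK | hK | hK
  · have hs : ∀ v w, vsep K v w = -1 * (form K v w - 1) := fun v w => by
      rw [vsep_of_neg hK, form_of_neg hK]; ring
    rw [onModel_of_neg hK] at hu hv
    simp only [Real.sign_of_neg hK, hs]
    rw [← gram (-1) _ _ _ _ _ _ (Or.inr rfl)]
    simp only [form_of_neg hK, vdet]
    have h1 : vdet u v w * vdet u v z = -((u 0 * u 0 + u 1 * u 1 - u 2 * u 2) *
      ((v 0 * v 0 + v 1 * v 1 - v 2 * v 2) * (w 0 * z 0 + w 1 * z 1 - w 2 * z 2) -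
        (v 0 * z 0 + v 1 * z 1 - v 2 * z 2) * (v 0 * w 0 + v 1 * w 1 - v 2 * w 2)) -
      (u 0 * v 0 + u 1 * v 1 - u 2 * v 2) * ((u 0 * v 0 + u 1 * v 1 - u 2 * v 2) *
        (w 0 * z 0 + w 1 * z 1 - w 2 * z 2) -
        (v 0 * z 0 + v 1 * z 1 - v 2 * z 2) * (u 0 * w 0 + u 1 * w 1 - u 2 * w 2)) +
      (u 0 * z 0 + u 1 * z 1 - u 2 * z 2) * ((u 0 * v 0 + u 1 * v 1 - u 2 * v 2) *
        (v 0 * w 0 + v 1 * w 1 - v 2 * w 2) -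
        (v 0 * v 0 + v 1 * v 1 - v 2 * v 2) * (u 0 * w 0 + u 1 * w 1 - u 2 * w 2))) := by
      simp only [vdet]; ring
    rw [hu, hv, vdet, vdet] at h1
    rw [h1]; ring
  · rw [onModel_of_zero hK] at hu hv hw hz
    simp only [hK, Real.sign_zero, vsep_of_zero rfl, vdet, hu, hv, hw, hz]
    ring
  · have hs : ∀ v w, vsep K v w = 1 * (form K v w - 1) := fun v w => by
      rw [vsep_of_pos hK, form_of_pos hK]; ring
    rw [onModel_of_pos hK] at hu hv
    simp only [Real.sign_of_pos hK, hs]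
    rw [← gram 1 _ _ _ _ _ _ (Or.inl rfl)]
    simp only [form_of_pos hK, vdet]
    have h1 : vdet u v w * vdet u v z = -((-(u 0 * u 0) + u 1 * u 1 + u 2 * u 2) *
      ((-(v 0 * v 0) + v 1 * v 1 + v 2 * v 2) * (-(w 0 * z 0) + w 1 * z 1 + w 2 * z 2) -
        (-(v 0 * z 0) + v 1 * z 1 + v 2 * z 2) * (-(v 0 * w 0) + v 1 * w 1 + v 2 * w 2)) -
      (-(u 0 * v 0) + u 1 * v 1 + u 2 * v 2) * ((-(u 0 * v 0) + u 1 * v 1 + u 2 * v 2) *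
        (-(w 0 * z 0) + w 1 * z 1 + w 2 * z 2) -
        (-(v 0 * z 0) + v 1 * z 1 + v 2 * z 2) * (-(u 0 * w 0) + u 1 * w 1 + u 2 * w 2)) +
      (-(u 0 * z 0) + u 1 * z 1 + u 2 * z 2) * ((-(u 0 * v 0) + u 1 * v 1 + u 2 * v 2) *
        (-(v 0 * w 0) + v 1 * w 1 + v 2 * w 2) -
        (-(v 0 * v 0) + v 1 * v 1 + v 2 * v 2) * (-(u 0 * w 0) + u 1 * w 1 + u 2 * w 2))) := by
      simp only [vdet]; ring
    rw [hu, hv, vdet, vdet] at h1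
    rw [h1]; ring

/-- This serves as a law of cosines for hinges: it is affine in `sep r s`, with coefficient positive
when `Chron p q`, so the five sides and the product of the signed areas determine `sep r s`. -/
lemma side_mul_side (p q r s : ModelSpace K) : side p q r * side p q s =
      sep p q * (2 + K.sign * sep p q) * sep r s
      + (sep p r - sep q r) * (sep p s - sep q s)
      - sep p q * (sep q r + sep q s + sep p r + sep p s) + sep p q ^ 2
      - K.sign * sep p q * (sep q r * sep p s + sep q s * sep p r) :=
  vdet_mul_vdet (onModel_vec _) (onModel_vec _) (onModel_vec _) (onModel_vec _)

lemma side_sq (p q r : ModelSpace K) :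
    side p q r ^ 2 = heron K.sign (sep p q) (sep q r) (sep p r) := by
  rw [sq, side_mul_side, sep_self, heron]
  ring

/-- A normal vector of the plane spanned by `u` and `v`. -/
noncomputable def normal (K : ℝ) (u v : Fin 3 → ℝ) : Fin 3 → ℝ :=
  ![(if K = 0 then 0 else -1) * (u 1 * v 2 - u 2 * v 1),
    (if 0 < K then 1 else -1) * (u 2 * v 0 - u 0 * v 2), u 0 * v 1 - u 1 * v 0]

/-- The third vertex of a triangle, in terms of the other two, the lengths `a`, `b`, `c` of its
sides in terms of `vsep`, and its signed area `d`. -/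
noncomputable def vertex (K : ℝ) (u v : Fin 3 → ℝ) (a b c d : ℝ) (i : Fin 3) : ℝ :=
  ((a + b - c + K.sign * a * b) * u i + (a + c - b + K.sign * a * c) * v i + d * normal K u v i) /
    (a * (2 + K.sign * a))

/-- If the Gram determinant of `u`, `v` does not vanish, then `u`, `v` and their normal form a
basis, and the coefficients of `w` are read off from its products with them. -/
lemma vertex_eq {u v w : Fin 3 → ℝ} (hu : OnModel K u) (hv : OnModel K v) (hw : OnModel K w)
    (h : vsep K u v * (2 + K.sign * vsep K u v) ≠ 0) :
    vertex K u v (vsep K u v) (vsep K v w) (vsep K u w) (vdet u v w) = w := by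
  funext i
  rw [vertex, div_eq_iff h]
  rcases lt_trichotomy K 0 with hK | hK | hK
  · rw [onModel_of_neg hK] at hu hv
    simp only [vsep_of_neg hK, Real.sign_of_neg hK, vdet, normal, hK.ne, hK.not_gt, if_false]
    -- Expansion of `w` in the basis `u`, `v`, normal, multiplied by the Gram determinant of `u` and
    -- `v`.
    have key : ∀ j, ![-1 * (u 1 * v 2 - u 2 * v 1), -1 * (u 2 * v 0 - u 0 * v 2),
        u 0 * v 1 - u 1 * v 0] j * vdet u v w =
        ((u 0 * u 0 + u 1 * u 1 - u 2 * u 2) * (v 0 * v 0 + v 1 * v 1 - v 2 * v 2) -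
          (u 0 * v 0 + u 1 * v 1 - u 2 * v 2) ^ 2) * w j
        - ((u 0 * w 0 + u 1 * w 1 - u 2 * w 2) * (v 0 * v 0 + v 1 * v 1 - v 2 * v 2) -
          (u 0 * v 0 + u 1 * v 1 - u 2 * v 2) * (v 0 * w 0 + v 1 * w 1 - v 2 * w 2)) * u j
        - ((v 0 * w 0 + v 1 * w 1 - v 2 * w 2) * (u 0 * u 0 + u 1 * u 1 - u 2 * u 2) -
          (u 0 * v 0 + u 1 * v 1 - u 2 * v 2) * (u 0 * w 0 + u 1 * w 1 - u 2 * w 2)) * v j := by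
      intro j
      fin_cases j <;> simp [vdet] <;> ring
    have := key i
    rw [hu, hv, vdet] at this
    linear_combination this
  · rw [onModel_of_zero hK] at hu hv hw
    simp only [hK, normal, Real.sign_zero, vsep_of_zero rfl, vdet, hu, hv, hw]
    fin_cases i <;> simp [hu, hv, hw] <;> ring
  · rw [onModel_of_pos hK] at hu hv
    simp only [vsep_of_pos hK, Real.sign_of_pos hK, vdet, normal, hK.ne', hK, if_false, if_true]
    have key : ∀ j, ![-1 * (u 1 * v 2 - u 2 * v 1), 1 * (u 2 * v 0 - u 0 * v 2),
        u 0 * v 1 - u 1 * v 0] j * vdet u v w =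
        -(((-(u 0 * u 0) + u 1 * u 1 + u 2 * u 2) * (-(v 0 * v 0) + v 1 * v 1 + v 2 * v 2) -
          (-(u 0 * v 0) + u 1 * v 1 + u 2 * v 2) ^ 2) * w j
        - ((-(u 0 * w 0) + u 1 * w 1 + u 2 * w 2) * (-(v 0 * v 0) + v 1 * v 1 + v 2 * v 2) -
          (-(u 0 * v 0) + u 1 * v 1 + u 2 * v 2) * (-(v 0 * w 0) + v 1 * w 1 + v 2 * w 2)) * u j
        - ((-(v 0 * w 0) + v 1 * w 1 + v 2 * w 2) * (-(u 0 * u 0) + u 1 * u 1 + u 2 * u 2) -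
          (-(u 0 * v 0) + u 1 * v 1 + u 2 * v 2) * (-(u 0 * w 0) + u 1 * w 1 + u 2 * w 2)) * v j)
          := by
      intro j
      fin_cases j <;> simp [vdet] <;> ring
    have := key i
    rw [hu, hv, vdet] at this
    linear_combination this

/-- Converse of `vertex_eq`: the two prescribed sides and the area come out by linear algebra, and
the condition on `d` is what puts the vector on the quadric if `K ≠ 0`, and gives it the right side
lengths if `K = 0`. -/
lemma vertex_spec {u v : Fin 3 → ℝ} (hu : OnModel K u) (hv : OnModel K v)
    (h : vsep K u v * (2 + K.sign * vsep K u v) ≠ 0) {b c d : ℝ}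
    (hd : d ^ 2 = heron K.sign (vsep K u v) b c) :
    OnModel K (vertex K u v (vsep K u v) b c d) ∧
    vsep K u (vertex K u v (vsep K u v) b c d) = c ∧
    vsep K v (vertex K u v (vsep K u v) b c d) = b ∧
    vdet u v (vertex K u v (vsep K u v) b c d) = d := by
  set a := vsep K u v with ha
  set k := a * (2 + K.sign * a) with hk
  set x := (a + b - c + K.sign * a * b) / k with hx
  set y := (a + c - b + K.sign * a * c) / k with hy
  set z := d / k with hz
  have hv3 : ∀ i, vertex K u v a b c d i = x * u i + y * v i + z * normal K u v i := fun i => by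
    rw [vertex, ← hk, hx, hy, hz]; ring
  have hx' : x * k = a + b - c + K.sign * a * b := div_mul_cancel₀ _ h
  have hy' : y * k = a + c - b + K.sign * a * c := div_mul_cancel₀ _ h
  have hz' : z * k = d := div_mul_cancel₀ _ h
  -- For `K ≠ 0` the normal has square `e * k` and is orthogonal to `u` and `v`, so the claims
  -- become three scalar identities in the coefficients `x`, `y`, `z`, proved after clearing the
  -- denominator `k`.
  have sc : ∀ e : ℝ, e = 1 ∨ e = -1 → K.sign = e →
      x ^ 2 + y ^ 2 + 2 * x * y * (1 + e * a) + e * z ^ 2 * k = 1 ∧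
      x + y * (1 + e * a) = 1 + e * c ∧ x * (1 + e * a) + y = 1 + e * b := by
    intro e he hs
    rw [hs] at hx' hy' hd hk
    have h1 : (x * k) ^ 2 + (y * k) ^ 2 + 2 * (x * k) * (y * k) * (1 + e * a) + e * (z * k) ^ 2 * k
        = k ^ 2 := by
      rw [hx', hy', hz', hd, hk, heron]
      rcases he with rfl | rfl <;> ring
    refine ⟨mul_left_cancel₀ (pow_ne_zero 2 h) ?_, mul_left_cancel₀ h ?_, mul_left_cancel₀ h ?_⟩
    · linear_combination h1
    · have : x * k + y * k * (1 + e * a) = k * (1 + e * c) := by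
        rw [hx', hy', hk]; rcases he with rfl | rfl <;> ring
      linear_combination this
    · have : x * k * (1 + e * a) + y * k = k * (1 + e * b) := by
        rw [hx', hy', hk]; rcases he with rfl | rfl <;> ring
      linear_combination this
  rcases lt_trichotomy K 0 with hK | hK | hK
  · obtain ⟨s1, s2, s3⟩ := sc (-1) (Or.inr rfl) (Real.sign_of_neg hK)
    rw [onModel_of_neg hK] at hu hv
    rw [onModel_of_neg hK, vsep_of_neg hK, vsep_of_neg hK]
    rw [vsep_of_neg hK] at ha
    rw [Real.sign_of_neg hK] at hk
    have hA : u 0 * v 0 + u 1 * v 1 - u 2 * v 2 = 1 - a := by rw [ha]; ring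
    simp only [vdet, hv3, normal, hK.ne, hK.not_gt, if_false, Matrix.cons_val]
    have hN : ∀ nu nv A : ℝ, nu = u 0 * u 0 + u 1 * u 1 - u 2 * u 2 →
        nv = v 0 * v 0 + v 1 * v 1 - v 2 * v 2 → A = u 0 * v 0 + u 1 * v 1 - u 2 * v 2 →
        (u 1 * v 2 - u 2 * v 1) ^ 2 + (u 2 * v 0 - u 0 * v 2) ^ 2 - (u 0 * v 1 - u 1 * v 0) ^ 2 =
          A ^ 2 - nu * nv := by
      rintro _ _ _ rfl rfl rfl; ring
    have hN' := hN 1 1 (1 - a) hu.symm hv.symm hA.symm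
    refine ⟨?_, ?_, ?_, ?_⟩
    · linear_combination s1 + x ^ 2 * hu + y ^ 2 * hv + 2 * x * y * hA + z ^ 2 * hN' + z ^ 2 * hk
    · linear_combination -x * hu - y * hA - s2
    · linear_combination -y * hv - x * hA - s3
    · linear_combination hz' - z * hN' - z * hk
  · rw [onModel_of_zero hK] at hu hv
    rw [onModel_of_zero hK, vsep_of_zero hK, vsep_of_zero hK]
    rw [vsep_of_zero hK, eq_div_iff two_ne_zero] at ha
    rw [hK, Real.sign_zero] at hk hx' hy' hd
    have ha0 : a ≠ 0 := by rintro h0; apply h; rw [hk, h0]; ring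
    have hk' : k = 2 * a := by linarith
    have hxy : x + y = 1 := by
      refine mul_left_cancel₀ h ?_
      linear_combination hx' + hy' - hk
    have hy2 : (y ^ 2 - z ^ 2) * a = c := by
      refine mul_left_cancel₀ (pow_ne_zero 2 h) ?_
      have : ((y * k) ^ 2 - (z * k) ^ 2) * a = k ^ 2 * c := by
        rw [hy', hz', hd, hk', heron]; ring
      linear_combination this
    have hx2 : (x ^ 2 - z ^ 2) * a = b := by
      refine mul_left_cancel₀ (pow_ne_zero 2 h) ?_
      have : ((x * k) ^ 2 - (z * k) ^ 2) * a = k ^ 2 * b := by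
        rw [hx', hz', hd, hk', heron]; ring
      linear_combination this
    have hx1 : x = 1 - y := by linarith
    simp only [vdet, hv3, normal, if_pos hK, if_neg hK.not_gt, Matrix.cons_val, hu, hv]
    refine ⟨?_, ?_, ?_, ?_⟩
    · linear_combination hxy
    · rw [hx1]; linear_combination hy2 - (y ^ 2 - z ^ 2) * ha / 2
    · rw [hx1] at hx2 ⊢
      linear_combination hx2 - ((1 - y) ^ 2 - z ^ 2) * ha / 2
    · rw [hx1]; linear_combination hz' - z * hk' - z * ha
  · obtain ⟨s1, s2, s3⟩ := sc 1 (Or.inl rfl) (Real.sign_of_pos hK)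
    rw [onModel_of_pos hK] at hu hv
    rw [onModel_of_pos hK, vsep_of_pos hK, vsep_of_pos hK]
    rw [vsep_of_pos hK] at ha
    rw [Real.sign_of_pos hK] at hk
    have hA : -(u 0 * v 0) + u 1 * v 1 + u 2 * v 2 = 1 + a := by rw [ha]; ring
    simp only [vdet, hv3, normal, hK.ne', hK, if_false, if_true, Matrix.cons_val]
    have hN : ∀ nu nv A : ℝ, nu = -(u 0 * u 0) + u 1 * u 1 + u 2 * u 2 →
        nv = -(v 0 * v 0) + v 1 * v 1 + v 2 * v 2 → A = -(u 0 * v 0) + u 1 * v 1 + u 2 * v 2 →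
        -(u 1 * v 2 - u 2 * v 1) ^ 2 + (u 2 * v 0 - u 0 * v 2) ^ 2 + (u 0 * v 1 - u 1 * v 0) ^ 2 =
          A ^ 2 - nu * nv := by
      rintro _ _ _ rfl rfl rfl; ring
    have hN' := hN 1 1 (1 + a) hu.symm hv.symm hA.symm
    refine ⟨?_, ?_, ?_, ?_⟩
    · linear_combination s1 + x ^ 2 * hu + y ^ 2 * hv + 2 * x * y * hA + z ^ 2 * hN' - z ^ 2 * hk
    · linear_combination x * hu + y * hA + s2
    · linear_combination y * hv + x * hA + s3
    · linear_combination hz' + z * hN' - z * hk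

/-- The point at distance `a` from `u` on the line through `u` and `v`. -/
noncomputable def linePoint (K : ℝ) (u v : Fin 3 → ℝ) (a : ℝ) (i : Fin 3) : ℝ :=
  (1 + K.sign * a - (1 + K.sign * vsep K u v) *
    √(a * (2 + K.sign * a) / (vsep K u v * (2 + K.sign * vsep K u v)))) * u i +
  √(a * (2 + K.sign * a) / (vsep K u v * (2 + K.sign * vsep K u v))) * v i

lemma linePoint_self {u v : Fin 3 → ℝ} (h : vsep K u v * (2 + K.sign * vsep K u v) ≠ 0) :
    linePoint K u v (vsep K u v) = v := by
  funext i
  rw [linePoint, div_self h, Real.sqrt_one]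
  ring

/-- In terms of the normalized length, `a * (2 + K.sign * a)` is its squared `sinh`, its square or
its squared `sin`. The coefficient of `v` is thus the usual ratio of such values along a geodesic.
-/
lemma linePoint_spec {u v : Fin 3 → ℝ} (hu : OnModel K u) (hv : OnModel K v)
    (h : 0 < vsep K u v * (2 + K.sign * vsep K u v)) {a : ℝ} (ha : 0 ≤ a * (2 + K.sign * a)) :
    OnModel K (linePoint K u v a) ∧ vsep K u (linePoint K u v a) = a := by
  unfold linePoint
  set m := √(a * (2 + K.sign * a) / (vsep K u v * (2 + K.sign * vsep K u v))) with hm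
  have hm2 : m ^ 2 * (vsep K u v * (2 + K.sign * vsep K u v)) = a * (2 + K.sign * a) := by
    rw [hm, Real.sq_sqrt (div_nonneg ha h.le), div_mul_cancel₀ _ h.ne']
  clear_value m
  set s := vsep K u v with hs
  clear_value s
  rcases lt_trichotomy K 0 with hK | hK | hK
  · rw [onModel_of_neg hK] at hu hv
    rw [onModel_of_neg hK, vsep_of_neg hK]
    rw [vsep_of_neg hK] at hs
    rw [Real.sign_of_neg hK] at hm2 ⊢
    have hA : u 0 * v 0 + u 1 * v 1 - u 2 * v 2 = 1 - s := by rw [hs]; ring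
    set x := 1 + -1 * a - (1 + -1 * s) * m with hx
    constructor
    · have e : x ^ 2 + m ^ 2 + 2 * x * m * (1 - s) = 1 := by rw [hx]; linear_combination hm2
      linear_combination e + x ^ 2 * hu + m ^ 2 * hv + 2 * x * m * hA
    · have e : 1 - (x + m * (1 - s)) = a := by rw [hx]; ring
      linear_combination e - x * hu - m * hA
  · rw [onModel_of_zero hK] at hu hv
    rw [onModel_of_zero hK, vsep_of_zero hK]
    rw [vsep_of_zero hK] at hs
    rw [hK, Real.sign_zero] at hm2 ⊢
    constructor
    · rw [hu, hv]; ring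
    · linear_combination hm2 / 2 - m ^ 2 * hs
  · rw [onModel_of_pos hK] at hu hv
    rw [onModel_of_pos hK, vsep_of_pos hK]
    rw [vsep_of_pos hK] at hs
    rw [Real.sign_of_pos hK] at hm2 ⊢
    have hA : -(u 0 * v 0) + u 1 * v 1 + u 2 * v 2 = 1 + s := by rw [hs]; ring
    set x := 1 + 1 * a - (1 + 1 * s) * m with hx
    constructor
    · have e : x ^ 2 + m ^ 2 + 2 * x * m * (1 + s) = 1 := by rw [hx]; linear_combination -hm2
      linear_combination e + x ^ 2 * hu + m ^ 2 * hv + 2 * x * m * hA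
    · have e : (x + m * (1 + s)) - 1 = a := by rw [hx]; ring
      linear_combination e + x * hu + m * hA

/-! ### Lifting from the ambient space to the model space -/

/-- The point with given coordinates. -/
def ofCoords (t x : ℝ) (ht : 0 < K → |t| < Real.pi / 2) (hx : K < 0 → |x| < Real.pi / 2) :
    ModelSpace K := ⟨(t, x), ht, hx⟩

lemma ext_coords {p q : ModelSpace K} (ht : p.time = q.time) (hx : p.pos = q.pos) : p = q :=
  Subtype.ext (Prod.ext ht hx)

lemma continuous_ofCoords {X : Type*} [TopologicalSpace X] {t x : X → ℝ} (ct : Continuous t)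
    (cx : Continuous x) (ht : ∀ v, 0 < K → |t v| < Real.pi / 2)
    (hx : ∀ v, K < 0 → |x v| < Real.pi / 2) :
    Continuous fun v => ofCoords (t v) (x v) (ht v) (hx v) :=
  (ct.prodMk cx).subtype_mk _

/-- The angle of `(b, c)` on the circle of radius `√(1 + a ^ 2)`, measured from the direction `t`,
is an arcsine on the half plane around that direction. This chooses the lift to the universal cover;
it serves both signs of `K`, with time and space interchanged. -/
lemma polar_lift {t a b c : ℝ} (h : b ^ 2 + c ^ 2 = 1 + a ^ 2)
    (h0 : 0 < Real.cos t * b + Real.sin t * c) :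
    Real.cos (t + Real.arcsin ((Real.cos t * c - Real.sin t * b) / √(1 + a ^ 2))) /
      Real.cos (Real.arctan a) = b ∧
    Real.sin (t + Real.arcsin ((Real.cos t * c - Real.sin t * b) / √(1 + a ^ 2))) /
      Real.cos (Real.arctan a) = c := by
  have hR : 0 < √(1 + a ^ 2) := Real.sqrt_pos.2 (by positivity)
  have hR2 : √(1 + a ^ 2) ^ 2 = 1 + a ^ 2 := Real.sq_sqrt (by positivity)
  have hcos : Real.cos (Real.arctan a) = 1 / √(1 + a ^ 2) := Real.cos_arctan a
  rw [hcos]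
  set R := √(1 + a ^ 2)
  set s := (Real.cos t * c - Real.sin t * b) / R with hs
  have hsR : s * R = Real.cos t * c - Real.sin t * b := div_mul_cancel₀ _ hR.ne'
  have ht := Real.sin_sq_add_cos_sq t
  have h1 : 1 - s ^ 2 = ((Real.cos t * b + Real.sin t * c) / R) ^ 2 := by
    rw [hs]; field_simp
    rw [hR2, ← h]
    linear_combination -(b ^ 2 + c ^ 2) * ht
  have h2 : Real.cos (Real.arcsin s) = (Real.cos t * b + Real.sin t * c) / R := by
    rw [Real.cos_arcsin, h1, Real.sqrt_sq (div_pos h0 hR).le]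
  have h3 : s ^ 2 ≤ 1 := by nlinarith [sq_nonneg ((Real.cos t * b + Real.sin t * c) / R)]
  have h4 := abs_le.1 ((sq_le_one_iff_abs_le_one s).1 h3)
  have h5 : Real.sin (Real.arcsin s) = s := Real.sin_arcsin h4.1 h4.2
  rw [Real.cos_add, Real.sin_add, h2, h5, hs]
  constructor
  · field_simp
    linear_combination b * ht
  · field_simp
    linear_combination c * ht

/-- Local sections of the covering map `vec`. -/
lemma exists_section (r : ModelSpace K) : ∃ f : (Fin 3 → ℝ) → ModelSpace K,
    Continuous f ∧ f r.vec = r ∧ ∀ᶠ v in 𝓝 r.vec, OnModel K v → (f v).vec = v := by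
  rcases lt_trichotomy K 0 with hK | hK | hK
  -- The formula is continuous on all of `ℝ³`, but inverts `vec` only on the quadric near `r.vec`.
  · refine ⟨fun v => ofCoords (r.time + Real.arcsin
      ((Real.cos r.time * v 1 - Real.sin r.time * v 0) / √(1 + v 2 ^ 2))) (Real.arctan (v 2))
      (fun h => absurd h hK.not_gt) (fun _ => ?_), ?_, ?_, ?_⟩
    · exact abs_lt.2 ⟨Real.neg_pi_div_two_lt_arctan _, Real.arctan_lt_pi_div_two _⟩
    · have : ∀ v : Fin 3 → ℝ, √(1 + v 2 ^ 2) ≠ 0 := fun v => (Real.sqrt_pos.2 (by positivity)).ne'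
      refine continuous_ofCoords ?_ ?_ _ _ <;> fun_prop (disch := exact this _)
    · have hx := abs_lt.1 (abs_pos_lt hK r)
      rw [vec_of_neg hK]
      simp only [Matrix.cons_val]
      have e : Real.cos r.time * (Real.sin r.time / Real.cos r.pos) -
        Real.sin r.time * (Real.cos r.time / Real.cos r.pos) = 0 := by ring
      simp only [e, zero_div, Real.arcsin_zero, add_zero]
      exact ext_coords rfl (Real.arctan_tan hx.1 hx.2)
    · have h0 : ∀ᶠ v in 𝓝 r.vec, 0 < Real.cos r.time * v 0 + Real.sin r.time * v 1 := by
        have hc : Continuous fun v : Fin 3 → ℝ =>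
          Real.cos r.time * v 0 + Real.sin r.time * v 1 := by fun_prop
        refine hc.continuousAt.eventually (lt_mem_nhds ?_)
        rw [vec_of_neg hK]
        simp only [Matrix.cons_val]
        have := cos_pos_pos hK r
        rw [show Real.cos r.time * (Real.cos r.time / Real.cos r.pos) +
          Real.sin r.time * (Real.sin r.time / Real.cos r.pos) =
          (Real.sin r.time ^ 2 + Real.cos r.time ^ 2) / Real.cos r.pos by ring,
          Real.sin_sq_add_cos_sq]
        positivity
      filter_upwards [h0] with v hv hm
      rw [onModel_of_neg hK] at hm
      obtain ⟨h1, h2⟩ := polar_lift (t := r.time) (a := v 2) (b := v 0) (c := v 1)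
        (by linear_combination hm) hv
      rw [vec_of_neg hK]
      funext i
      fin_cases i
      · exact h1
      · exact h2
      · exact Real.tan_arctan _
  · refine ⟨fun v => ofCoords (v 1) (v 2) (fun h => absurd h (by simp [hK]))
      (fun h => absurd h (by simp [hK])), ?_, ?_, ?_⟩
    · exact continuous_ofCoords (by fun_prop) (by fun_prop) _ _
    · rw [vec_of_zero hK]
      exact ext_coords rfl rfl
    · refine Eventually.of_forall fun v hm => ?_
      rw [onModel_of_zero hK] at hm
      rw [vec_of_zero hK]
      funext i
      fin_cases i
      · exact hm.symm
      · rfl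
      · rfl
  · refine ⟨fun v => ofCoords (Real.arctan (v 0)) (r.pos + Real.arcsin
      ((Real.cos r.pos * v 2 - Real.sin r.pos * v 1) / √(1 + v 0 ^ 2))) (fun _ => ?_)
      (fun h => absurd h hK.not_gt), ?_, ?_, ?_⟩
    · exact abs_lt.2 ⟨Real.neg_pi_div_two_lt_arctan _, Real.arctan_lt_pi_div_two _⟩
    · have : ∀ v : Fin 3 → ℝ, √(1 + v 0 ^ 2) ≠ 0 := fun v => (Real.sqrt_pos.2 (by positivity)).ne'
      refine continuous_ofCoords ?_ ?_ _ _ <;> fun_prop (disch := exact this _)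
    · have hx := abs_lt.1 (abs_time_lt hK r)
      rw [vec_of_pos hK]
      simp only [Matrix.cons_val]
      have e : Real.cos r.pos * (Real.sin r.pos / Real.cos r.time) -
        Real.sin r.pos * (Real.cos r.pos / Real.cos r.time) = 0 := by ring
      simp only [e, zero_div, Real.arcsin_zero, add_zero]
      exact ext_coords (Real.arctan_tan hx.1 hx.2) rfl
    · have h0 : ∀ᶠ v in 𝓝 r.vec, 0 < Real.cos r.pos * v 1 + Real.sin r.pos * v 2 := by
        have hc : Continuous fun v : Fin 3 → ℝ =>
          Real.cos r.pos * v 1 + Real.sin r.pos * v 2 := by fun_prop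
        refine hc.continuousAt.eventually (lt_mem_nhds ?_)
        rw [vec_of_pos hK]
        simp only [Matrix.cons_val]
        have := cos_time_pos hK r
        rw [show Real.cos r.pos * (Real.cos r.pos / Real.cos r.time) +
          Real.sin r.pos * (Real.sin r.pos / Real.cos r.time) =
          (Real.sin r.pos ^ 2 + Real.cos r.pos ^ 2) / Real.cos r.time by ring,
          Real.sin_sq_add_cos_sq]
        positivity
      filter_upwards [h0] with v hv hm
      rw [onModel_of_pos hK] at hm
      obtain ⟨h1, h2⟩ := polar_lift (t := r.pos) (a := v 0) (b := v 1) (c := v 2)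
        (by linear_combination hm) hv
      rw [vec_of_pos hK]
      funext i
      fin_cases i
      · exact Real.tan_arctan _
      · exact h1
      · exact h2

/-- Nondegeneracy of the base `p`, `q`, needed to solve for a third vertex; for `K < 0` it rests on
`sep < 2`. -/
lemma Chron.area_pos {p q : ModelSpace K} (h : Chron p q) :
    0 < sep p q * (2 + K.sign * sep p q) := by
  have h0 := h.sep_pos
  refine mul_pos h0 ?_
  rcases lt_trichotomy K 0 with hK | hK | hK
  · rw [Real.sign_of_neg hK]; linarith [h.sep_lt_two hK]
  · rw [Real.sign_eq_zero_iff.2 hK]; linarith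
  · rw [Real.sign_of_pos hK]; linarith

/-- Triangles near a given one, with the first vertex kept, depend continuously on the second
vertex, the remaining sides and the signed area. -/
lemma Chron.exists_vertex {p q : ModelSpace K} (h : Chron p q) (r : ModelSpace K) :
    ∃ f : ModelSpace K × ℝ × ℝ × ℝ → ModelSpace K,
      ContinuousAt f (q, sep q r, sep p r, side p q r) ∧
      f (q, sep q r, sep p r, side p q r) = r ∧
      ∀ᶠ x in 𝓝 (q, sep q r, sep p r, side p q r),
        x.2.2.2 ^ 2 = heron K.sign (sep p x.1) x.2.1 x.2.2.1 →
        sep x.1 (f x) = x.2.1 ∧ sep p (f x) = x.2.2.1 ∧ side p x.1 (f x) = x.2.2.2 := by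
  obtain ⟨g, gc, gr, gv⟩ := exists_section r
  set x₀ : ModelSpace K × ℝ × ℝ × ℝ := (q, sep q r, sep p r, side p q r) with hx₀
  let w : ModelSpace K × ℝ × ℝ × ℝ → Fin 3 → ℝ := fun x =>
    vertex K p.vec x.1.vec (vsep K p.vec x.1.vec) x.2.1 x.2.2.1 x.2.2.2
  have hw₀ : w x₀ = r.vec :=
    vertex_eq (onModel_vec p) (onModel_vec q) (onModel_vec r) h.area_pos.ne'
  have hvec : Continuous fun x : ModelSpace K × ℝ × ℝ × ℝ => x.1.vec :=
    continuous_vec.comp continuous_fst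
  have hsep : Continuous fun x : ModelSpace K × ℝ × ℝ × ℝ => vsep K p.vec x.1.vec :=
    continuous_vsep.comp (continuous_const.prodMk hvec)
  have hwc : ContinuousAt w x₀ := by
    refine continuousAt_pi.2 fun i => ?_
    have hi : ∀ i, Continuous fun x : ModelSpace K × ℝ × ℝ × ℝ => x.1.vec i :=
      fun i => (continuous_apply i).comp hvec
    have h0 := hi 0
    have h1 := hi 1
    have h2 := hi 2
    have hn : Continuous fun x : ModelSpace K × ℝ × ℝ × ℝ => normal K p.vec x.1.vec i := by
      unfold normal
      fin_cases i <;> simp only [Fin.zero_eta, Fin.mk_one, Fin.reduceFinMk, Matrix.cons_val]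
        <;> fun_prop
    have hii := hi i
    refine ContinuousAt.div (Continuous.continuousAt ?_) (Continuous.continuousAt ?_)
      h.area_pos.ne'
    · fun_prop
    · fun_prop
  refine ⟨fun x => g (w x), ?_, ?_, ?_⟩
  · exact ContinuousAt.comp (f := w) gc.continuousAt hwc
  · simp only [hw₀, gr]
  · have h1 : ∀ᶠ x in 𝓝 x₀, OnModel K (w x) → (g (w x)).vec = w x := by
      have := hwc.tendsto
      rw [hw₀] at this
      exact this.eventually gv
    have h2 : ∀ᶠ x in 𝓝 x₀, Chron p x.1 := by
      have hc : Continuous fun x : ModelSpace K × ℝ × ℝ × ℝ => (p, x.1) := by fun_prop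
      exact (hc.tendsto x₀).eventually (isOpen_chron.mem_nhds h)
    filter_upwards [h1, h2] with x hx1 hx2 hd
    obtain ⟨e1, e2, e3, e4⟩ := vertex_spec (onModel_vec p) (onModel_vec x.1) hx2.area_pos.ne' hd
    have e := hx1 e1
    rw [sep, sep, side, e]
    exact ⟨e3, e2, e4⟩

lemma Chron.exists_linePoint {p q : ModelSpace K} (h : Chron p q) :
    ∃ f : ℝ → ModelSpace K, ContinuousAt f (sep p q) ∧ f (sep p q) = q ∧
      ∀ᶠ a in 𝓝 (sep p q), sep p (f a) = a := by
  obtain ⟨g, gc, gr, gv⟩ := exists_section q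
  have hw₀ : linePoint K p.vec q.vec (sep p q) = q.vec := linePoint_self h.area_pos.ne'
  have hwc : Continuous (linePoint K p.vec q.vec) := by
    refine continuous_pi fun i => ?_
    unfold linePoint
    fun_prop
  refine ⟨fun a => g (linePoint K p.vec q.vec a), (gc.comp hwc).continuousAt, by
    simp only [hw₀, gr], ?_⟩
  have h1 : ∀ᶠ a in 𝓝 (sep p q), OnModel K (linePoint K p.vec q.vec a) →
      (g (linePoint K p.vec q.vec a)).vec = linePoint K p.vec q.vec a := by
    have := hwc.tendsto (sep p q)
    rw [hw₀] at this
    exact this.eventually gv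
  have h2 : ∀ᶠ a in 𝓝 (sep p q), 0 < a * (2 + K.sign * a) := by
    have hc : Continuous fun a : ℝ => a * (2 + K.sign * a) := by fun_prop
    exact hc.continuousAt.eventually (lt_mem_nhds h.area_pos)
  filter_upwards [h1, h2] with a ha1 ha2
  obtain ⟨e1, e2⟩ := linePoint_spec (onModel_vec p) (onModel_vec q) h.area_pos ha2.le
  rw [sep, ha1 e1, e2]

/-! ### Hinges with perturbed side lengths -/

/-- Completing the square in `c` isolates the term of the law of cosines. For fixed `a` and `b`, the
squared area therefore increases with `c` once `c - a - b - e * a * b ≥ 0`. -/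
lemma heron_eq (e a b c : ℝ) : heron e a b c =
    (c - a - b - e * a * b) ^ 2 - a * b * ((2 + e * a) * (2 + e * b)) := by
  rw [heron]; ring

lemma sepOfTau_mono {r s : ℝ} (hr : 0 ≤ r) (h : r ≤ s)
    (hs : ENNReal.ofReal s < modelDiameter K) : sepOfTau K r ≤ sepOfTau K s := by
  unfold sepOfTau
  split_ifs with h1 h2
  · have : Real.cosh (√K * r) ≤ Real.cosh (√K * s) := by
      rw [Real.cosh_le_cosh, abs_of_nonneg (by positivity),
        abs_of_nonneg (mul_nonneg (Real.sqrt_nonneg _) (hr.trans h))]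
      gcongr
    linarith
  · gcongr
  · have hK : K < 0 := lt_of_le_of_ne (not_lt.1 h1) h2
    have := Real.cos_le_cos_of_nonneg_of_le_pi (x := √(-K) * r) (y := √(-K) * s) (by positivity)
      (sqrt_neg_mul_lt_pi hK hs).le (by gcongr)
    linarith

/-- The reverse triangle inequality, in terms of `sep`. -/
lemma sepOfTau_triangle {a b c : ℝ} (ha : 0 < a) (hb : 0 < b) (h : a + b ≤ c)
    (hc : ENNReal.ofReal c < modelDiameter K) :
    0 ≤ sepOfTau K c - sepOfTau K a - sepOfTau K b - K.sign * sepOfTau K a * sepOfTau K b ∧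
    0 ≤ heron K.sign (sepOfTau K a) (sepOfTau K b) (sepOfTau K c) := by
  have hm := sepOfTau_mono (by positivity) h hc
  rcases lt_trichotomy K 0 with hK | hK | hK
  · have hs : 0 < √(-K) := Real.sqrt_pos.2 (by linarith)
    simp only [sepOfTau, if_neg hK.not_gt, if_neg hK.ne, Real.sign_of_neg hK, heron, mul_add,
      Real.cos_add] at *
    have hpi := sqrt_neg_mul_lt_pi hK hc
    have hx : 0 < √(-K) * a := by positivity
    have hy : 0 < √(-K) * b := by positivity
    have hxy : √(-K) * a + √(-K) * b ≤ √(-K) * c := by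
      rw [← mul_add]; gcongr
    set x := √(-K) * a
    set y := √(-K) * b
    set z := √(-K) * c
    have sx := Real.sin_pos_of_pos_of_lt_pi hx (by linarith)
    have sy := Real.sin_pos_of_pos_of_lt_pi hy (by linarith)
    have hss := mul_pos sx sy
    have px := Real.sin_sq_add_cos_sq x
    have py := Real.sin_sq_add_cos_sq y
    constructor
    · nlinarith
    -- Heron's factorization `(cos (x + y) - cos z) * (cos (x - y) - cos z)`; both factors are
    -- nonnegative.
    · have e : (Real.cos x * Real.cos y - Real.sin x * Real.sin y - Real.cos z) *
          (Real.cos x * Real.cos y + Real.sin x * Real.sin y - Real.cos z) =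
          (Real.cos x * Real.cos y - Real.cos z) ^ 2
            - (1 - Real.cos x ^ 2) * (1 - Real.cos y ^ 2) := by
        have hsx : Real.sin x ^ 2 = 1 - Real.cos x ^ 2 := by linarith
        have hsy : Real.sin y ^ 2 = 1 - Real.cos y ^ 2 := by linarith
        rw [← hsx, ← hsy]; ring
      have := mul_nonneg (a := Real.cos x * Real.cos y - Real.sin x * Real.sin y - Real.cos z)
        (b := Real.cos x * Real.cos y + Real.sin x * Real.sin y - Real.cos z)
        (by linarith) (by linarith)
      rw [e] at this
      linarith
  · simp only [sepOfTau, if_neg hK.not_gt, if_pos hK, Real.sign_eq_zero_iff.2 hK, heron] at *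
    constructor
    · nlinarith
    · have e : ((c - a) ^ 2 - b ^ 2) * ((c + a) ^ 2 - b ^ 2) / 4 =
        (a ^ 2 / 2) ^ 2 + (b ^ 2 / 2) ^ 2 + (c ^ 2 / 2) ^ 2 - 2 * (a ^ 2 / 2 * (b ^ 2 / 2) +
          b ^ 2 / 2 * (c ^ 2 / 2) + c ^ 2 / 2 * (a ^ 2 / 2))
          - 2 * 0 * (a ^ 2 / 2) * (b ^ 2 / 2) * (c ^ 2 / 2) := by ring
      rw [← e]
      have h1 : 0 ≤ (c - a) ^ 2 - b ^ 2 := by nlinarith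
      have h2 : 0 ≤ (c + a) ^ 2 - b ^ 2 := by nlinarith
      positivity
  · have hs : 0 < √K := Real.sqrt_pos.2 hK
    simp only [sepOfTau, if_pos hK, Real.sign_of_pos hK, heron, mul_add, Real.cosh_add] at *
    have hx : 0 < √K * a := by positivity
    have hy : 0 < √K * b := by positivity
    set x := √K * a
    set y := √K * b
    set z := √K * c
    have sx := Real.sinh_pos_iff.2 hx
    have sy := Real.sinh_pos_iff.2 hy
    have hss := mul_pos sx sy
    have px := Real.cosh_sq x
    have py := Real.cosh_sq y
    constructor
    · nlinarith
    · have e : (Real.cosh z - (Real.cosh x * Real.cosh y + Real.sinh x * Real.sinh y)) *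
          (Real.cosh z - (Real.cosh x * Real.cosh y - Real.sinh x * Real.sinh y)) =
          (Real.cosh x * Real.cosh y - Real.cosh z) ^ 2
            - (Real.cosh x ^ 2 - 1) * (Real.cosh y ^ 2 - 1) := by
        rw [px, py]; ring
      have := mul_nonneg
        (a := Real.cosh z - (Real.cosh x * Real.cosh y + Real.sinh x * Real.sinh y))
        (b := Real.cosh z - (Real.cosh x * Real.cosh y - Real.sinh x * Real.sinh y))
        (by linarith) (by linarith)
      rw [e] at this
      linarith

/-- A degenerate triangle lies on both sides of the line. One sign `s`, chosen in advance, fixes the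
branches of the square roots for the signed areas, so that opposite sides survive perturbation. -/
lemma exists_sign {x y : ℝ} (h : x * y ≤ 0) :
    ∃ s : ℝ, s ^ 2 = 1 ∧ 0 ≤ s * x ∧ 0 ≤ -s * y := by
  rcases lt_trichotomy x 0 with hx | hx | hx
  · exact ⟨-1, by norm_num, by linarith, by nlinarith⟩
  · rcases le_total 0 y with hy | hy
    · exact ⟨-1, by norm_num, by simp [hx], by linarith⟩
    · exact ⟨1, by norm_num, by simp [hx], by linarith⟩
  · exact ⟨1, by norm_num, by linarith, by nlinarith⟩

lemma eq_mul_sqrt_sq {s x : ℝ} (hs : s ^ 2 = 1) (h : 0 ≤ s * x) : x = s * √(x ^ 2) := by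
  have : √(x ^ 2) = s * x := by
    rw [show x ^ 2 = (s * x) ^ 2 by rw [mul_pow, hs, one_mul], Real.sqrt_sq h]
  rw [this, ← mul_assoc, ← sq, hs, one_mul]

lemma mul_nonpos_of_signs {s x y : ℝ} (hs : s ^ 2 = 1) (hx : 0 ≤ s * x) (hy : 0 ≤ -s * y) :
    x * y ≤ 0 := by
  have := mul_nonneg hx hy
  have e : s * x * (-s * y) = -(s ^ 2 * (x * y)) := by ring
  rw [e, hs] at this
  linarith

lemma isOpen_lt_modelDiameter : IsOpen {r : ℝ | ENNReal.ofReal r < modelDiameter K} :=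
  isOpen_lt ENNReal.continuous_ofReal continuous_const

lemma exists_line_near {p q : ModelSpace K} {a : ℝ} (ha : 0 < a)
    (hD : ENNReal.ofReal a < modelDiameter K) (h : tau p q = ENNReal.ofReal a) :
    ∃ f : ℝ → ModelSpace K, ContinuousAt f a ∧ f a = q ∧
      ∀ᶠ x in 𝓝 a, tau p (f x) = ENNReal.ofReal x := by
  obtain ⟨hc, hs⟩ := (tau_eq_ofReal_iff ha hD).1 h
  obtain ⟨f, fc, fq, fe⟩ := hc.exists_linePoint
  rw [hs] at fc fq fe
  have hf : ContinuousAt (fun x => f (sepOfTau K x)) a :=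
    ContinuousAt.comp (f := sepOfTau K) fc continuous_sepOfTau.continuousAt
  have hch : ∀ᶠ x in 𝓝 a, Chron p (f (sepOfTau K x)) := by
    have h1 : Tendsto (fun x => (p, f (sepOfTau K x))) (𝓝 a) (𝓝 (p, q)) := by
      have := hf.tendsto
      rw [fq] at this
      exact tendsto_const_nhds.prodMk_nhds this
    exact h1.eventually (isOpen_chron.mem_nhds hc)
  refine ⟨fun x => f (sepOfTau K x), hf, fq, ?_⟩
  filter_upwards [hch, continuous_sepOfTau.continuousAt.eventually fe, lt_mem_nhds ha,
    isOpen_lt_modelDiameter.mem_nhds hD] with x h1 h2 h3 h4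
  exact (tau_eq_ofReal_iff h3 h4).2 ⟨h1, h2⟩

/-- The third vertex is solved for with signed area `s * √heron`. This is continuous also at
degenerate triangles, and it is the area of an actual triangle because `heron ≥ 0` by the reverse
triangle inequality, which is why `x.1 + x.2.1 ≤ x.2.2` is required. -/
lemma exists_triangle_near {p q r : ModelSpace K} {a b c : ℝ} (ha : 0 < a) (hb : 0 < b)
    (habc : a + b ≤ c) (hD : ENNReal.ofReal c < modelDiameter K)
    (hpq : tau p q = ENNReal.ofReal a) (hqr : tau q r = ENNReal.ofReal b)
    (hpr : tau p r = ENNReal.ofReal c) {s : ℝ} (hs : s ^ 2 = 1) (hside : 0 ≤ s * side p q r)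
    {f : ℝ → ModelSpace K} (hf : ContinuousAt f a) (hfa : f a = q) :
    ∃ g : ℝ × ℝ × ℝ → ModelSpace K, ContinuousAt g (a, b, c) ∧ g (a, b, c) = r ∧
      ∀ᶠ x in 𝓝 (a, b, c), tau p (f x.1) = ENNReal.ofReal x.1 → x.1 + x.2.1 ≤ x.2.2 →
        tau (f x.1) (g x) = ENNReal.ofReal x.2.1 ∧ tau p (g x) = ENNReal.ofReal x.2.2 ∧
        0 ≤ s * side p (f x.1) (g x) := by
  have hDa : ENNReal.ofReal a < modelDiameter K :=
    (ENNReal.ofReal_le_ofReal (by linarith)).trans_lt hD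
  have hDb : ENNReal.ofReal b < modelDiameter K :=
    (ENNReal.ofReal_le_ofReal (by linarith)).trans_lt hD
  have hc : 0 < c := by linarith
  obtain ⟨cpq, spq⟩ := (tau_eq_ofReal_iff ha hDa).1 hpq
  obtain ⟨cqr, sqr⟩ := (tau_eq_ofReal_iff hb hDb).1 hqr
  obtain ⟨cpr, spr⟩ := (tau_eq_ofReal_iff hc hD).1 hpr
  obtain ⟨v, vc, vr, ve⟩ := cpq.exists_vertex r
  have hS := continuous_sepOfTau (K := K)
  let w : ℝ × ℝ × ℝ → ModelSpace K × ℝ × ℝ × ℝ := fun x =>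
    (f x.1, sepOfTau K x.2.1, sepOfTau K x.2.2,
      s * √(heron K.sign (sepOfTau K x.1) (sepOfTau K x.2.1) (sepOfTau K x.2.2)))
  have hw₀ : w (a, b, c) = (q, sep q r, sep p r, side p q r) := by
    simp only [w, hfa]
    rw [← spq, ← sqr, ← spr, ← side_sq, ← eq_mul_sqrt_sq hs hside]
  have hwc : ContinuousAt w (a, b, c) := by
    have h1 : ContinuousAt (fun x : ℝ × ℝ × ℝ => f x.1) (a, b, c) :=
      ContinuousAt.comp (f := Prod.fst) hf continuousAt_fst
    refine h1.prodMk (Continuous.continuousAt ?_)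
    unfold heron
    fun_prop
  have hw : Tendsto w (𝓝 (a, b, c)) (𝓝 (q, sep q r, sep p r, side p q r)) := by
    have := hwc.tendsto
    rwa [hw₀] at this
  have hg : Tendsto (fun x => v (w x)) (𝓝 (a, b, c)) (𝓝 r) := by
    have := vc.tendsto.comp hw
    rwa [vr] at this
  have hgr : v (w (a, b, c)) = r := by rw [hw₀, vr]
  have hf' : Tendsto (fun x : ℝ × ℝ × ℝ => f x.1) (𝓝 (a, b, c)) (𝓝 q) := by
    have := hf.tendsto
    rw [hfa] at this
    exact this.comp (continuous_fst.tendsto (a, b, c))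
  have e1 : ∀ᶠ x in 𝓝 (a, b, c), Chron p (v (w x)) :=
    (tendsto_const_nhds.prodMk_nhds hg).eventually (isOpen_chron.mem_nhds cpr)
  have e2 : ∀ᶠ x in 𝓝 (a, b, c), Chron (f x.1) (v (w x)) :=
    (hf'.prodMk_nhds hg).eventually (isOpen_chron.mem_nhds cqr)
  have e3 : ∀ᶠ x : ℝ × ℝ × ℝ in 𝓝 (a, b, c), 0 < x.1 :=
    (continuous_fst.tendsto (a, b, c)).eventually (lt_mem_nhds ha)
  have e4 : ∀ᶠ x : ℝ × ℝ × ℝ in 𝓝 (a, b, c), 0 < x.2.1 :=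
    ((continuous_fst.comp continuous_snd).tendsto (a, b, c)).eventually (lt_mem_nhds hb)
  have e5 : ∀ᶠ x : ℝ × ℝ × ℝ in 𝓝 (a, b, c), ENNReal.ofReal x.2.2 < modelDiameter K :=
    ((continuous_snd.comp continuous_snd).tendsto (a, b, c)).eventually
      (isOpen_lt_modelDiameter.mem_nhds hD)
  refine ⟨fun x => v (w x), by rw [ContinuousAt, hgr]; exact hg, hgr, ?_⟩
  filter_upwards [hw.eventually ve, e1, e2, e3, e4, e5] with x hx c1 c2 xa xb xD hfx hle
  have hDx1 : ENNReal.ofReal x.1 < modelDiameter K :=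
    (ENNReal.ofReal_le_ofReal (by linarith)).trans_lt xD
  have hDx2 : ENNReal.ofReal x.2.1 < modelDiameter K :=
    (ENNReal.ofReal_le_ofReal (by linarith)).trans_lt xD
  have hsx := ((tau_eq_ofReal_iff xa hDx1).1 hfx).2
  have hH := (sepOfTau_triangle xa xb hle xD).2
  obtain ⟨h1, h2, h3⟩ := hx (by
    simp only [w]
    rw [mul_pow, hs, one_mul, Real.sq_sqrt hH, hsx])
  refine ⟨(tau_eq_ofReal_iff xb hDx2).2 ⟨c2, h1⟩, (tau_eq_ofReal_iff (by linarith) xD).2 ⟨c1, h2⟩,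
    ?_⟩
  have h3' : side p (f x.1) (v (w x)) = s * √(heron K.sign (sepOfTau K x.1) (sepOfTau K x.2.1)
    (sepOfTau K x.2.2)) := h3
  rw [h3', ← mul_assoc, ← sq, hs, one_mul]
  exact Real.sqrt_nonneg _

/-- A hinge in the model space: `p ≪ q ≪ r` and `p ≪ q ≪ s` with given finite side lengths, and
`r`, `s` on opposite sides of the line through `p` and `q`. -/
structure IsHinge (p q r s : ModelSpace K) (a b₁ c₁ b₂ c₂ : ℝ) : Prop where
  tau_pq : tau p q = ENNReal.ofReal a
  tau_qr : tau q r = ENNReal.ofReal b₁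
  tau_pr : tau p r = ENNReal.ofReal c₁
  tau_qs : tau q s = ENNReal.ofReal b₂
  tau_ps : tau p s = ENNReal.ofReal c₂
  opposite : OppositeSides p q r s

/-- Admissible side lengths of hinges. -/
structure HingeData (K a b₁ c₁ b₂ c₂ : ℝ) : Prop where
  a_pos : 0 < a
  b₁_pos : 0 < b₁
  b₂_pos : 0 < b₂
  le₁ : a + b₁ ≤ c₁
  le₂ : a + b₂ ≤ c₂
  lt₁ : ENNReal.ofReal c₁ < modelDiameter K
  lt₂ : ENNReal.ofReal c₂ < modelDiameter K

lemma caus_of_tau_pos {p q : ModelSpace K} (h : 0 < tau p q) : Caus p q := by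
  by_contra hc
  rw [tau, if_neg (show ¬ |q.pos - p.pos| ≤ _ from hc)] at h
  exact lt_irrefl _ h

lemma Caus.refl (p : ModelSpace K) : Caus p p := by simp [Caus]

lemma Chron.chron_of_tau_pos {p q r : ModelSpace K} (h : Chron p r) (h1 : Caus p q)
    (h2 : 0 < tau q r) : Chron q r := by
  have hc := caus_of_tau_pos h2
  have hb := h.bound h1 (Caus.refl r)
  refine hc.chron_of_sep_ne_zero (fun h0 => ?_) hb
  rw [tau_of_caus hc fun hK => (hb hK).le, h0, tauOfSep_zero, ENNReal.ofReal_zero] at h2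
  exact lt_irrefl _ h2

lemma HingeData.chron {p q r s : ModelSpace K} {a b₁ c₁ b₂ c₂ : ℝ}
    (hd : HingeData K a b₁ c₁ b₂ c₂) (h : IsHinge p q r s a b₁ c₁ b₂ c₂) :
    (Chron p q ∧ sep p q = sepOfTau K a) ∧ (Chron q r ∧ sep q r = sepOfTau K b₁) ∧
    (Chron p r ∧ sep p r = sepOfTau K c₁) ∧ (Chron q s ∧ sep q s = sepOfTau K b₂) ∧
    (Chron p s ∧ sep p s = sepOfTau K c₂) := by
  obtain ⟨ha, hb1, hb2, h1, h2, hD1, hD2⟩ := hd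
  refine ⟨(tau_eq_ofReal_iff ha ?_).1 h.tau_pq, (tau_eq_ofReal_iff hb1 ?_).1 h.tau_qr,
    (tau_eq_ofReal_iff (by linarith) hD1).1 h.tau_pr, (tau_eq_ofReal_iff hb2 ?_).1 h.tau_qs,
    (tau_eq_ofReal_iff (by linarith) hD2).1 h.tau_ps⟩
  · exact (ENNReal.ofReal_le_ofReal (by linarith)).trans_lt hD1
  · exact (ENNReal.ofReal_le_ofReal (by linarith)).trans_lt hD1
  · exact (ENNReal.ofReal_le_ofReal (by linarith)).trans_lt hD2

/-- Hinges with nearby side lengths, whose end points have at least nearly the same time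
separation. -/
lemma HingeData.exists_near {p q r s : ModelSpace K} {a b₁ c₁ b₂ c₂ : ℝ}
    (hd : HingeData K a b₁ c₁ b₂ c₂) (h : IsHinge p q r s a b₁ c₁ b₂ c₂) {R : ℝ≥0∞}
    (hR : R < tau r s) :
    ∀ᶠ x : ℝ × ℝ × ℝ × ℝ × ℝ in 𝓝 (a, b₁, c₁, b₂, c₂), x.1 + x.2.1 ≤ x.2.2.1 →
      x.1 + x.2.2.2.1 ≤ x.2.2.2.2 → ∃ q' r' s' : ModelSpace K,
        IsHinge p q' r' s' x.1 x.2.1 x.2.2.1 x.2.2.2.1 x.2.2.2.2 ∧ R < tau r' s' := by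
  obtain ⟨-, -, ⟨cpr, -⟩, -, ⟨cps, -⟩⟩ := hd.chron h
  have crs : Chron r s := cps.chron_of_tau_pos cpr.caus (bot_le.trans_lt hR)
  obtain ⟨ha, hb1, hb2, h1, h2, hD1, hD2⟩ := hd
  -- The vertex `p` is kept, `q` moves on its line through `p`, and the two outer vertices are
  -- solved for over the common side, with opposite signs of the area.
  obtain ⟨f, fc, fa, fe⟩ := exists_line_near ha
    ((ENNReal.ofReal_le_ofReal (by linarith)).trans_lt hD1) h.tau_pq
  obtain ⟨σ, hσ, hσ1, hσ2⟩ := exists_sign (oppositeSides_iff.1 h.opposite)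
  obtain ⟨g₁, gc₁, gr₁, ge₁⟩ := exists_triangle_near ha hb1 h1 hD1 h.tau_pq h.tau_qr h.tau_pr hσ
    hσ1 fc fa
  obtain ⟨g₂, gc₂, gr₂, ge₂⟩ := exists_triangle_near ha hb2 h2 hD2 h.tau_pq h.tau_qs h.tau_ps
    (by rw [neg_sq, hσ]) hσ2 fc fa
  have t₀ : Tendsto (fun x : ℝ × ℝ × ℝ × ℝ × ℝ => x.1) (𝓝 (a, b₁, c₁, b₂, c₂)) (𝓝 a) :=
    continuous_fst.tendsto (a, b₁, c₁, b₂, c₂)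
  have t₁ : Tendsto (fun x : ℝ × ℝ × ℝ × ℝ × ℝ => (x.1, x.2.1, x.2.2.1))
      (𝓝 (a, b₁, c₁, b₂, c₂)) (𝓝 (a, b₁, c₁)) :=
    Continuous.tendsto (f := fun x : ℝ × ℝ × ℝ × ℝ × ℝ => (x.1, x.2.1, x.2.2.1)) (by fun_prop)
      (a, b₁, c₁, b₂, c₂)
  have t₂ : Tendsto (fun x : ℝ × ℝ × ℝ × ℝ × ℝ => (x.1, x.2.2.2.1, x.2.2.2.2))
      (𝓝 (a, b₁, c₁, b₂, c₂)) (𝓝 (a, b₂, c₂)) :=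
    Continuous.tendsto (f := fun x : ℝ × ℝ × ℝ × ℝ × ℝ => (x.1, x.2.2.2.1, x.2.2.2.2))
      (by fun_prop) (a, b₁, c₁, b₂, c₂)
  have hlim : ∀ᶠ x : ℝ × ℝ × ℝ × ℝ × ℝ in 𝓝 (a, b₁, c₁, b₂, c₂),
      R < tau (g₁ (x.1, x.2.1, x.2.2.1)) (g₂ (x.1, x.2.2.2.1, x.2.2.2.2)) := by
    have l₁ := gc₁.tendsto.comp t₁
    have l₂ := gc₂.tendsto.comp t₂
    rw [gr₁] at l₁
    rw [gr₂] at l₂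
    exact (crs.continuousAt_tau.tendsto.comp (l₁.prodMk_nhds l₂)).eventually (lt_mem_nhds hR)
  filter_upwards [t₀.eventually fe, t₁.eventually ge₁, t₂.eventually ge₂, hlim]
    with x x0 x1 x2 x3 l1 l2
  obtain ⟨y1, y2, y3⟩ := x1 x0 l1
  obtain ⟨z1, z2, z3⟩ := x2 x0 l2
  exact ⟨f x.1, _, _, ⟨x0, y1, y2, z1, z2,
    oppositeSides_iff.2 (mul_nonpos_of_signs hσ y3 z3)⟩, x3⟩

/-! ### Closing the angle of a hinge -/

/-- Here `X`, `X'`, `Y` are signed areas. Shrinking `c` to `c'` shrinks the area by `heron_eq`, so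
the nonpositive product with `Y` increases. The difference of the two laws of cosines is `k * (S' -
S) = (X' * Y - X * Y) + (c - c') * (c₂ - a - b₂ - e * a * b₂)` with `k = a * (2 + e * a)`, and both
terms are nonnegative. -/
lemma sep_le_sep {e a b c c' b₂ c₂ S S' X X' Y : ℝ} (hk : 0 < a * (2 + e * a))
    (hc : c' ≤ c) (h₁ : 0 ≤ c' - a - b - e * a * b) (h₂ : 0 ≤ c₂ - a - b₂ - e * a * b₂)
    (hX : X ^ 2 = heron e a b c) (hX' : X' ^ 2 = heron e a b c') (hXY : X * Y ≤ 0)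
    (hXY' : X' * Y ≤ 0)
    (hS : X * Y = a * (2 + e * a) * S + (c - b) * (c₂ - b₂) - a * (b + b₂ + c + c₂) + a ^ 2
      - e * a * (b * c₂ + b₂ * c))
    (hS' : X' * Y = a * (2 + e * a) * S' + (c' - b) * (c₂ - b₂) - a * (b + b₂ + c' + c₂) + a ^ 2
      - e * a * (b * c₂ + b₂ * c')) : S ≤ S' := by
  rw [heron_eq] at hX hX'
  have h3 : |X'| ≤ |X| := by
    apply sq_le_sq.1
    rw [hX, hX']
    have := pow_le_pow_left₀ h₁ (by linarith : c' - a - b - e * a * b ≤ c - a - b - e * a * b) 2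
    linarith
  have h4 : X * Y ≤ X' * Y := by
    have := mul_le_mul_of_nonneg_right h3 (abs_nonneg Y)
    rw [← abs_mul, ← abs_mul, abs_of_nonpos hXY, abs_of_nonpos hXY'] at this
    linarith
  have h5 := mul_nonneg (sub_nonneg.2 hc) h₂
  refine le_of_mul_le_mul_left ?_ hk
  linarith

/-- In the coordinates a diamond is a closed bounded subset of the plane. For `K > 0` it stays in
the strip since its times lie between those of `p` and `q`; for `K < 0` this is what the second
condition of `Chron` provides. -/
lemma isCompact_diamond {p q : ModelSpace K} (h : Chron p q) :
    IsCompact {z : ModelSpace K | Caus p z ∧ Caus z q} := by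
  have hemb : Topology.IsEmbedding (fun z : ModelSpace K => ((z.time, z.pos) : ℝ × ℝ)) :=
    Topology.IsEmbedding.subtypeVal
  rw [hemb.isCompact_iff]
  have himg : (fun z : ModelSpace K => ((z.time, z.pos) : ℝ × ℝ)) ''
      {z : ModelSpace K | Caus p z ∧ Caus z q} =
      {x : ℝ × ℝ | |x.2 - p.pos| ≤ x.1 - p.time ∧ |q.pos - x.2| ≤ q.time - x.1} := by
    ext x
    constructor
    · rintro ⟨z, hz, rfl⟩
      exact hz
    · rintro ⟨h1, h2⟩
      have h1' := abs_le.1 h1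
      have h2' := abs_le.1 h2
      refine ⟨ofCoords x.1 x.2 (fun hK => ?_) (fun hK => ?_), ⟨h1, h2⟩, rfl⟩
      · have hp := abs_lt.1 (abs_time_lt hK p)
        have hq := abs_lt.1 (abs_time_lt hK q)
        rw [abs_lt]
        constructor <;> linarith
      · have hb := h.2 hK
        have := neg_abs_le (p.pos + q.pos)
        have := le_abs_self (p.pos + q.pos)
        rw [abs_lt]
        constructor <;> linarith
  rw [himg]
  refine (isCompact_Icc (a := ((p.time, p.pos - (q.time - p.time)) : ℝ × ℝ))
    (b := (q.time, p.pos + (q.time - p.time)))).of_isClosed_subset ?_ ?_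
  · exact (isClosed_le (f := fun x : ℝ × ℝ => |x.2 - p.pos|) (g := fun x => x.1 - p.time)
      (by fun_prop) (by fun_prop)).inter (isClosed_le (f := fun x : ℝ × ℝ => |q.pos - x.2|)
        (g := fun x => q.time - x.1) (by fun_prop) (by fun_prop))
  · rintro x ⟨h1, h2⟩
    have h1' := abs_le.1 h1
    have h2' := abs_le.1 h2
    refine ⟨⟨?_, ?_⟩, ⟨?_, ?_⟩⟩ <;> simp only <;> linarith

lemma continuous_sep_right (p : ModelSpace K) : Continuous (sep p) := by
  have h : Continuous fun z : ModelSpace K => (p, z) := by fun_prop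
  simpa only [Function.comp_def] using continuous_sep.comp h

lemma continuous_side_right (p q : ModelSpace K) : Continuous (side p q) := by
  have h : Continuous fun z : ModelSpace K => (p, q, z) := by fun_prop
  simpa only [Function.comp_def] using continuous_side.comp h

/-- If the end points of a hinge are timelike related, then the same holds for the hinges
with a smaller side `c`. -/
lemma HingeData.exists_slide {p q r s : ModelSpace K} {a b₁ c₁ b₂ c₂ : ℝ}
    (hd : HingeData K a b₁ c₁ b₂ c₂) (h : IsHinge p q r s a b₁ c₁ b₂ c₂) (hrs : 0 < tau r s)
    {c : ℝ} (hc : a + b₁ ≤ c) (hc' : c ≤ c₁) :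
    ∃ r' : ModelSpace K, IsHinge p q r' s a b₁ c b₂ c₂ ∧ 0 < tau r' s := by
  obtain ⟨⟨cpq, spq⟩, ⟨cqr, sqr⟩, ⟨cpr, spr⟩, ⟨cqs, sqs⟩, ⟨cps, sps⟩⟩ := hd.chron h
  have crs : Chron r s := cps.chron_of_tau_pos cpr.caus hrs
  obtain ⟨ha, hb1, hb2, h1, h2, hD1, hD2⟩ := hd
  obtain ⟨σ, hσ, hσ1, hσ2⟩ := exists_sign (oppositeSides_iff.1 h.opposite)
  have hDb : ENNReal.ofReal b₁ < modelDiameter K :=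
    (ENNReal.ofReal_le_ofReal (by linarith)).trans_lt hD1
  set E : ModelSpace K → ℝ := fun z => sep p z - sepOfTau K a - sepOfTau K b₁
    - K.sign * sepOfTau K a * sepOfTau K b₁ with hE
  -- Candidates for `r'`: between `q` and `s`, at the right distance from `q`, on the right side,
  -- with the third side in the allowed range. The condition `0 ≤ E z` is the consequence of `a + b₁
  -- ≤ c` that `sep_le_sep` needs.
  set C : Set (ModelSpace K) := {z | Caus q z ∧ Caus z s} ∩
    {z | sep q z = sepOfTau K b₁ ∧ 0 ≤ σ * side p q z ∧ 0 ≤ E z ∧ sep p z ≤ sepOfTau K c₁} with hC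
  have contp := continuous_sep_right p
  have contq := continuous_sep_right q
  have contd := continuous_side_right p q
  have hCc : IsCompact C := by
    refine (isCompact_diamond cqs).inter_right ?_
    have i1 : IsClosed {z : ModelSpace K | sep q z = sepOfTau K b₁} :=
      isClosed_eq contq continuous_const
    have i2 : IsClosed {z : ModelSpace K | 0 ≤ σ * side p q z} :=
      isClosed_le continuous_const (by fun_prop)
    have i3 : IsClosed {z : ModelSpace K | 0 ≤ E z} :=
      isClosed_le continuous_const (by fun_prop)
    have i4 : IsClosed {z : ModelSpace K | sep p z ≤ sepOfTau K c₁} :=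
      isClosed_le contp continuous_const
    exact i1.inter (i2.inter (i3.inter i4))
  -- Candidates cannot reach the light cone of `s`, because `sep z s ≥ sep r s > 0` by `sep_le_sep`.
  have hpos : ∀ z ∈ C, Chron p z ∧ Chron q z ∧ Chron z s := by
    rintro z ⟨⟨z1, z2⟩, z3, z4, z5, z6⟩
    have cqz : Chron q z := by
      refine z1.chron_of_sep_ne_zero ?_ (cqs.bound (Caus.refl q) z2)
      rw [z3, ← sqr]
      exact cqr.sep_pos.ne'
    have cpz : Chron p z :=
      ⟨by
        have hq := cpq.1
        have hz := cqz.1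
        rw [abs_lt] at *
        constructor <;> linarith, cps.bound (Caus.refl p) z2⟩
    refine ⟨cpz, cqz, z2.chron_of_sep_ne_zero (ne_of_gt ?_) (cps.bound cpz.caus (Caus.refl s))⟩
    refine crs.sep_pos.trans_le ?_
    have e1 := side_mul_side p q r s
    have e2 := side_mul_side p q z s
    refine sep_le_sep cpq.area_pos (z6.trans_eq spr.symm) ?_ ?_ (side_sq p q r) ?_
      (oppositeSides_iff.1 h.opposite) (mul_nonpos_of_signs hσ z4 hσ2) e1 ?_
    · rw [sqr, spq]; exact z5
    · rw [sps, spq, sqs]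
      exact (sepOfTau_triangle ha hb2 h2 hD2).1
    · rw [side_sq, z3, sqr]
    · rw [e2, z3, sqr]
  have htau : ∀ z ∈ C, tau p z = ENNReal.ofReal (tauOfSep K (sep p z)) :=
    fun z hz => (hpos z hz).1.tau_eq
  have hcomp : IsCompact ((fun z => tauOfSep K (sep p z)) '' C) := by
    refine hCc.image_of_continuousOn fun z hz => ContinuousAt.continuousWithinAt ?_
    exact ContinuousAt.comp (f := sep p) (continuousAt_tauOfSep (hpos z hz).1.sep_pos)
      contp.continuousAt
  -- Continuity method, downwards from `c₁`, which `r` attains: the attained lengths form a closed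
  -- set by compactness of `C`, and slightly shorter ones are attained by perturbing the triangle
  -- over the fixed side from `p` to `q`.
  have hsub : Icc (a + b₁) c₁ ⊆ (fun z => tauOfSep K (sep p z)) '' C := by
    refine (hcomp.isClosed.inter isClosed_Icc).Icc_subset_of_forall_exists_lt ?_ ?_
    · refine ⟨r, ⟨⟨cqr.caus, crs.caus⟩, sqr, hσ1, ?_, spr.le⟩, ?_⟩
      · simp only [hE, spr]
        exact (sepOfTau_triangle ha hb1 h1 hD1).1
      · simp only [spr]
        exact tauOfSep_sepOfTau (by linarith) hD1
    · rintro x ⟨⟨z, hz, hzx⟩, hx1, hx2⟩ y hy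
      simp only at hzx
      obtain ⟨cpz, cqz, czs⟩ := hpos z hz
      have hDx : ENNReal.ofReal x < modelDiameter K :=
        (ENNReal.ofReal_le_ofReal hx2).trans_lt hD1
      obtain ⟨g, gc, gz, ge⟩ := exists_triangle_near (r := z) (c := x) ha hb1 hx1.le hDx h.tau_pq
        ((tau_eq_ofReal_iff hb1 hDb).2 ⟨cqz, hz.2.1⟩) (by rw [htau z hz, hzx]) hσ hz.2.2.1
        (f := fun _ => q) continuousAt_const rfl
      have hcurve : Tendsto (fun t : ℝ => (a, b₁, t)) (𝓝[<] x) (𝓝 (a, b₁, x)) :=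
        (Continuous.tendsto (f := fun t : ℝ => (a, b₁, t)) (by fun_prop) x).mono_left
          nhdsWithin_le_nhds
      have hgs : ∀ᶠ t in 𝓝[<] x, Chron (g (a, b₁, t)) s := by
        have := gc.tendsto.comp hcurve
        rw [gz] at this
        exact (this.prodMk_nhds tendsto_const_nhds).eventually (isOpen_chron.mem_nhds czs)
      have hlt : ∀ᶠ t in 𝓝[<] x, t ∈ Ioo (max y (a + b₁)) x :=
        Ioo_mem_nhdsLT (max_lt hy hx1)
      obtain ⟨t, t1, t2, t3⟩ := ((hcurve.eventually ge).and (hgs.and hlt)).exists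
      have ty := (le_max_left _ _).trans_lt t3.1
      have tab := (le_max_right _ _).trans_lt t3.1
      obtain ⟨k1, k2, k3⟩ := t1 h.tau_pq tab.le
      have hDt : ENNReal.ofReal t < modelDiameter K :=
        (ENNReal.ofReal_le_ofReal t3.2.le).trans_lt hDx
      obtain ⟨m1, m2⟩ := (tau_eq_ofReal_iff hb1 hDb).1 k1
      obtain ⟨m3, m4⟩ := (tau_eq_ofReal_iff (by linarith) hDt).1 k2
      refine ⟨t, ⟨g (a, b₁, t), ⟨⟨m1.caus, t2.caus⟩, m2, k3, ?_, ?_⟩, ?_⟩, ty.le, t3.2⟩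
      · simp only [hE, m4]
        exact (sepOfTau_triangle ha hb1 tab.le hDt).1
      · rw [m4]
        exact sepOfTau_mono (by linarith) (t3.2.le.trans hx2) hD1
      · simp only [m4]
        exact tauOfSep_sepOfTau (by linarith) hDt
  obtain ⟨z, hz, hzc⟩ := hsub ⟨hc, hc'⟩
  simp only at hzc
  obtain ⟨-, cqz, czs⟩ := hpos z hz
  exact ⟨z, ⟨h.tau_pq, (tau_eq_ofReal_iff hb1 hDb).2 ⟨cqz, hz.2.1⟩, by rw [htau z hz, hzc],
    h.tau_qs, h.tau_ps, oppositeSides_iff.2 (mul_nonpos_of_signs hσ hz.2.2.1 hσ2)⟩, czs.tau_pos⟩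

/-! ### Time reversal -/

/-- Time reversal. -/
def reverse (p : ModelSpace K) : ModelSpace K :=
  ofCoords (-p.time) p.pos (fun h => by rw [abs_neg]; exact abs_time_lt h p)
    fun h => abs_pos_lt h p

lemma time_reverse (p : ModelSpace K) : p.reverse.time = -p.time := rfl

lemma pos_reverse (p : ModelSpace K) : p.reverse.pos = p.pos := rfl

lemma tau_reverse (p q : ModelSpace K) : tau q.reverse p.reverse = tau p q := by
  have h1 : p.pos - q.pos = -(q.pos - p.pos) := by ring
  have h2 : -p.time - -q.time = q.time - p.time := by ring
  rcases lt_trichotomy K 0 with hK | hK | hK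
  · simp only [tau, vec_of_neg hK, time_reverse, pos_reverse, h1, h2, abs_neg, if_neg hK.not_gt,
      if_neg hK.ne, Matrix.cons_val, Real.cos_neg, Real.sin_neg, add_comm q.pos]
    congr 6 <;> ring
  · simp only [tau, time_reverse, pos_reverse, h1, h2, abs_neg, if_neg hK.not_gt,
      if_pos hK, neg_sq]
  · simp only [tau, vec_of_pos hK, time_reverse, pos_reverse, h1, h2, abs_neg, if_pos hK,
      Matrix.cons_val, Real.cos_neg, Real.tan_neg]
    congr 4
    ring

lemma side_reverse (p q r : ModelSpace K) :
    side p.reverse q.reverse r.reverse = -side p q r := by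
  rcases lt_trichotomy K 0 with hK | hK | hK
  · simp only [side, vec_of_neg hK, vdet, time_reverse, pos_reverse, Matrix.cons_val,
      Real.cos_neg, Real.sin_neg]
    ring
  · simp only [side, vec_of_zero hK, vdet, time_reverse, pos_reverse, Matrix.cons_val]
    ring
  · simp only [side, vec_of_pos hK, vdet, time_reverse, pos_reverse, Matrix.cons_val,
      Real.cos_neg, Real.tan_neg]
    ring

lemma oppositeSides_reverse {p q r s : ModelSpace K} :
    OppositeSides p.reverse q.reverse r.reverse s.reverse ↔ OppositeSides p q r s := by
  rw [oppositeSides_iff, oppositeSides_iff, side_reverse, side_reverse, neg_mul_neg]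

end ModelSpace

namespace LorentzianPreLengthSpace

variable {Y : Type*} [MetricSpace Y]

/-- The same space with the opposite time orientation. -/
def reverse (L : LorentzianPreLengthSpace Y) : LorentzianPreLengthSpace Y where
  le x y := L.le y x
  ll x y := L.ll y x
  tau x y := L.tau y x
  separable := L.separable
  le_refl := L.le_refl
  le_trans x y z h h' := L.le_trans z y x h' h
  ll_trans x y z h h' := L.ll_trans z y x h' h
  le_of_ll x y h := L.le_of_ll y x h
  lowerSemicontinuous_tau := L.lowerSemicontinuous_tau.comp continuous_swap
  tau_eq_zero x y h := L.tau_eq_zero y x h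
  tau_pos_iff x y := L.tau_pos_iff y x
  reverse_triangle x y z h h' := by
    rw [add_comm]
    exact L.reverse_triangle z y x h' h

/-! ### Four-point conditions, hinges and maximizing curves in pre-length spaces -/

variable (L : LorentzianPreLengthSpace Y)

/-- The future four-point condition. -/
def FutureCurvatureGE (K : ℝ) : Prop :=
  ∀ y x z₁ z₂ : Y, L.ll y x → L.ll x z₁ → L.le z₁ z₂ → L.tau y z₂ < modelDiameter K →
    ∀ y' x' z₁' z₂' : ModelSpace K, L.IsFutureComparison K y x z₁ z₂ y' x' z₁' z₂' →
      z₁'.tau z₂' ≤ L.tau z₁ z₂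

/-- The past four-point condition. -/
def PastCurvatureGE (K : ℝ) : Prop :=
  ∀ z₂ z₁ x y : Y, L.le z₂ z₁ → L.ll z₁ x → L.ll x y → L.tau z₂ y < modelDiameter K →
    ∀ z₂' z₁' x' y' : ModelSpace K, L.IsPastComparison K z₂ z₁ x y z₂' z₁' x' y' →
      z₂'.tau z₁' ≤ L.tau z₂ z₁

variable {L} {K : ℝ}

lemma PastCurvatureGE.reverse (h : L.PastCurvatureGE K) : L.reverse.FutureCurvatureGE K := by
  intro y x z₁ z₂ h1 h2 h3 h4 y' x' z₁' z₂' hc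
  rw [← ModelSpace.tau_reverse]
  refine h z₂ z₁ x y h3 h2 h1 h4 _ _ x'.reverse y'.reverse ⟨?_, ?_, ?_, ?_, ?_, ?_⟩
  · rw [ModelSpace.tau_reverse]; exact hc.tau_yx
  · rw [ModelSpace.tau_reverse]; exact hc.tau_yz₁
  · rw [ModelSpace.tau_reverse]; exact hc.tau_yz₂
  · rw [ModelSpace.tau_reverse]; exact hc.tau_xz₁
  · rw [ModelSpace.tau_reverse]; exact hc.tau_xz₂
  · exact ModelSpace.oppositeSides_reverse.2 hc.opposite

lemma FutureCurvatureGE.of_reverse (h : L.reverse.FutureCurvatureGE K) : L.PastCurvatureGE K := by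
  intro z₂ z₁ x y h3 h2 h1 h4 z₂' z₁' x' y' hc
  rw [← ModelSpace.tau_reverse]
  refine h y x z₁ z₂ h1 h2 h3 h4 y'.reverse x'.reverse _ _ ⟨?_, ?_, ?_, ?_, ?_, ?_⟩
  · rw [ModelSpace.tau_reverse]; exact hc.tau_xy
  · rw [ModelSpace.tau_reverse]; exact hc.tau_z₁y
  · rw [ModelSpace.tau_reverse]; exact hc.tau_z₂y
  · rw [ModelSpace.tau_reverse]; exact hc.tau_z₁x
  · rw [ModelSpace.tau_reverse]; exact hc.tau_z₂x
  · exact ModelSpace.oppositeSides_reverse.2 hc.opposite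

lemma add_toReal_le {x y z : Y} (h1 : L.le x y) (h2 : L.le y z) (h3 : L.tau x z ≠ ⊤) :
    (L.tau x y).toReal + (L.tau y z).toReal ≤ (L.tau x z).toReal := by
  have h := L.reverse_triangle x y z h1 h2
  have hs := ne_top_of_le_ne_top h3 h
  rw [← ENNReal.toReal_add (ENNReal.add_ne_top.1 hs).1 (ENNReal.add_ne_top.1 hs).2]
  exact ENNReal.toReal_mono h3 h

lemma toReal_tau_pos {x y : Y} (h : L.ll x y) (h' : L.tau x y ≠ ⊤) : 0 < (L.tau x y).toReal :=
  ENNReal.toReal_pos ((L.tau_pos_iff x y).2 h).ne' h'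

lemma tau_left_le {x y z : Y} (h1 : L.le x y) (h2 : L.le y z) : L.tau x y ≤ L.tau x z :=
  le_self_add.trans (L.reverse_triangle x y z h1 h2)

lemma tau_right_le {x y z : Y} (h1 : L.le x y) (h2 : L.le y z) : L.tau y z ≤ L.tau x z :=
  le_add_self.trans (L.reverse_triangle x y z h1 h2)

lemma ll_of_ll_of_le {x y z : Y} (h1 : L.ll x y) (h2 : L.le y z) : L.ll x z :=
  (L.tau_pos_iff x z).1 (((L.tau_pos_iff x y).2 h1).trans_le (tau_left_le (L.le_of_ll _ _ h1) h2))

lemma hingeData {y x z₁ z₂ : Y} (hyx : L.ll y x) (h1 : L.ll x z₁) (h2 : L.ll x z₂)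
    (hD1 : L.tau y z₁ < modelDiameter K) (hD2 : L.tau y z₂ < modelDiameter K) :
    ModelSpace.HingeData K (L.tau y x).toReal (L.tau x z₁).toReal (L.tau y z₁).toReal
      (L.tau x z₂).toReal (L.tau y z₂).toReal := by
  have lyx := L.le_of_ll _ _ hyx
  have l1 := L.le_of_ll _ _ h1
  have l2 := L.le_of_ll _ _ h2
  refine ⟨toReal_tau_pos hyx (ne_top_of_le_ne_top hD1.ne_top (tau_left_le lyx l1)),
    toReal_tau_pos h1 (ne_top_of_le_ne_top hD1.ne_top (tau_right_le lyx l1)),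
    toReal_tau_pos h2 (ne_top_of_le_ne_top hD2.ne_top (tau_right_le lyx l2)),
    add_toReal_le lyx l1 hD1.ne_top, add_toReal_le lyx l2 hD2.ne_top, ?_, ?_⟩
  · rwa [ENNReal.ofReal_toReal hD1.ne_top]
  · rwa [ENNReal.ofReal_toReal hD2.ne_top]

lemma isHinge_iff {y x z₁ z₂ : Y} (hyx : L.ll y x) (h1 : L.ll x z₁) (h2 : L.ll x z₂)
    (hD1 : L.tau y z₁ ≠ ⊤) (hD2 : L.tau y z₂ ≠ ⊤) {y' x' z₁' z₂' : ModelSpace K} :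
    ModelSpace.IsHinge y' x' z₁' z₂' (L.tau y x).toReal (L.tau x z₁).toReal (L.tau y z₁).toReal
      (L.tau x z₂).toReal (L.tau y z₂).toReal ↔
      L.IsFutureComparison K y x z₁ z₂ y' x' z₁' z₂' := by
  have lyx := L.le_of_ll _ _ hyx
  have l1 := L.le_of_ll _ _ h1
  have l2 := L.le_of_ll _ _ h2
  have e1 := ENNReal.ofReal_toReal (ne_top_of_le_ne_top hD1 (tau_left_le lyx l1))
  have e2 := ENNReal.ofReal_toReal (ne_top_of_le_ne_top hD1 (tau_right_le lyx l1))
  have e3 := ENNReal.ofReal_toReal (ne_top_of_le_ne_top hD2 (tau_right_le lyx l2))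
  have e4 := ENNReal.ofReal_toReal hD1
  have e5 := ENNReal.ofReal_toReal hD2
  constructor
  · rintro ⟨k1, k2, k3, k4, k5, k6⟩
    rw [e1] at k1; rw [e2] at k2; rw [e4] at k3; rw [e3] at k4; rw [e5] at k5
    exact ⟨k1.symm, k3.symm, k5.symm, k2.symm, k4.symm, k6⟩
  · rintro ⟨k1, k2, k3, k4, k5, k6⟩
    refine ⟨?_, ?_, ?_, ?_, ?_, k6⟩
    · rw [e1, k1]
    · rw [e2, k4]
    · rw [e4, k2]
    · rw [e3, k5]
    · rw [e5, k3]

/-- Any two causally related points are joined by a continuous causal curve that realizes their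
time separation. -/
def HasMaximizers (L : LorentzianPreLengthSpace Y) : Prop :=
  ∀ x y : Y, L.le x y → x ≠ y → ∃ (a b : ℝ) (γ : ℝ → Y), a < b ∧ ContinuousOn γ (Icc a b) ∧
    γ a = x ∧ γ b = y ∧ (∀ s ∈ Icc a b, ∀ t ∈ Icc a b, s ≤ t → L.le (γ s) (γ t)) ∧
    ∀ t ∈ Icc a b, L.tau x y ≤ L.tau x (γ t) + L.tau (γ t) y

lemma tauLength_le {γ : ℝ → Y} {a t b : ℝ} (h1 : a < t) (h2 : t < b) :
    L.tauLength γ a b ≤ L.tau (γ a) (γ t) + L.tau (γ t) (γ b) := by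
  -- The partition `a < t < b`; values beyond index `2` play no role.
  let p : ℕ → ℝ := fun i => if i = 0 then a else if i = 1 then t else b
  have hp : StrictMonoOn p (Iic 2) := by
    intro i hi j hj hij
    simp only [mem_Iic] at hi hj
    have : (i = 0 ∧ j = 1) ∨ (i = 0 ∧ j = 2) ∨ (i = 1 ∧ j = 2) := by omega
    rcases this with ⟨rfl, rfl⟩ | ⟨rfl, rfl⟩ | ⟨rfl, rfl⟩ <;> simp only [p] <;> norm_num <;>
      linarith
  refine iInf_le_of_le 2 ?_
  refine iInf_le_of_le p ?_
  refine iInf_le_of_le hp ?_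
  refine iInf_le_of_le rfl ?_
  refine iInf_le_of_le rfl ?_
  simp [Finset.sum_range_succ, p]

/-- The length of a curve is at most its sum over any partition, so a curve realizing `τ(x, y)`
satisfies the inequality opposite to the reverse triangle inequality at each of its points. -/
lemma IsGeodesic.hasMaximizers (h : L.IsGeodesic) : L.HasMaximizers := by
  intro x y hxy hne
  obtain ⟨a, b, γ, hab, hc, ha, hb, hl⟩ := h.geodesic x y hxy hne
  refine ⟨a, b, γ, hab, hc.locallyLipschitz.continuousOn, ha, hb, hc.causal, fun t ht => ?_⟩
  rcases eq_or_lt_of_le ht.1 with h1 | h1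
  · rw [← h1, ha]; exact le_add_self
  rcases eq_or_lt_of_le ht.2 with h2 | h2
  · rw [h2, hb]; exact le_self_add
  rw [← hl, ← ha, ← hb]
  exact tauLength_le h1 h2

lemma HasMaximizers.reverse (h : L.HasMaximizers) : L.reverse.HasMaximizers := by
  intro x y hxy hne
  obtain ⟨a, b, γ, hab, hc, ha, hb, hl, ht⟩ := h y x hxy hne.symm
  have hmem : ∀ t ∈ Icc (-b) (-a), -t ∈ Icc a b := fun t ht =>
    ⟨by linarith [ht.2], by linarith [ht.1]⟩
  refine ⟨-b, -a, fun t => γ (-t), by linarith, hc.comp continuous_neg.continuousOn hmem,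
    by simp [hb], by simp [ha], fun s hs t ht hst => hl _ (hmem t ht) _ (hmem s hs) (by linarith),
    fun t hmt => ?_⟩
  rw [add_comm]
  exact ht _ (hmem t hmt)

/-! ### Passing the four-point condition to the limit -/

/-- Quadruples of points can be approximated by quadruples in the spaces `L i`, such that the
positive time separations are nearly preserved. -/
def Approximable {Y : ℕ → Type*} [∀ i, MetricSpace (Y i)] {Z : Type*} [MetricSpace Z]
    (L : ∀ i, LorentzianPreLengthSpace (Y i)) (M : LorentzianPreLengthSpace Z) : Prop :=
  ∀ (p : Fin 4 → Z) (η : ℝ), 0 < η → ∃ (i : ℕ) (p' : Fin 4 → Y i), ∀ m n, M.ll (p m) (p n) →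
    (L i).ll (p' m) (p' n) ∧ (L i).tau (p' m) (p' n) ≠ ⊤ ∧
    |((L i).tau (p' m) (p' n)).toReal - (M.tau (p m) (p n)).toReal| < η

lemma Approximable.reverse {Y : ℕ → Type*} [∀ i, MetricSpace (Y i)] {Z : Type*} [MetricSpace Z]
    {L : ∀ i, LorentzianPreLengthSpace (Y i)} {M : LorentzianPreLengthSpace Z}
    (h : Approximable L M) : Approximable (fun i => (L i).reverse) M.reverse := by
  intro p η hη
  obtain ⟨i, p', hp⟩ := h p η hη
  exact ⟨i, p', fun m n => hp n m⟩

section Limit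

variable {Y : ℕ → Type*} [∀ i, MetricSpace (Y i)] {Z : Type*} [MetricSpace Z]
  {L : ∀ i, LorentzianPreLengthSpace (Y i)} {M : LorentzianPreLengthSpace Z}

/-- Since `z₁ ≪ z₂`, the four-point condition applies to the approximating quadruple; a violation in
the limit is stable under small changes of all time separations and would persist there. -/
lemma tau_le_of_approximable (happ : Approximable L M) (hL : ∀ i, (L i).FutureCurvatureGE K)
    (hfin : ∀ x y, M.tau x y ≠ ⊤) {y x z₁ z₂ : Z} (hyx : M.ll y x) (h1 : M.ll x z₁)
    (h12 : M.ll z₁ z₂) (hD : M.tau y z₂ < modelDiameter K) {y' x' z₁' z₂' : ModelSpace K}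
    (hc : M.IsFutureComparison K y x z₁ z₂ y' x' z₁' z₂') : z₁'.tau z₂' ≤ M.tau z₁ z₂ := by
  by_contra! hlt
  obtain ⟨R, hR1, hR2⟩ := ENNReal.lt_iff_exists_nnreal_btwn.1 hlt
  have h2 : M.ll x z₂ := M.ll_trans _ _ _ h1 h12
  have hD1 : M.tau y z₁ < modelDiameter K :=
    (tau_left_le (M.le_of_ll _ _ (M.ll_trans _ _ _ hyx h1)) (M.le_of_ll _ _ h12)).trans_lt hD
  have hd := hingeData hyx h1 h2 hD1 hD
  have hh := (isHinge_iff (K := K) hyx h1 h2 (hfin _ _) (hfin _ _)).2 hc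
  have near := hd.exists_near hh hR2
  have hDn : ∀ᶠ v : ℝ × ℝ × ℝ × ℝ × ℝ in 𝓝 ((M.tau y x).toReal, (M.tau x z₁).toReal,
      (M.tau y z₁).toReal, (M.tau x z₂).toReal, (M.tau y z₂).toReal),
      ENNReal.ofReal v.2.2.2.2 < modelDiameter K := by
    refine (Continuous.tendsto (f := fun v : ℝ × ℝ × ℝ × ℝ × ℝ => v.2.2.2.2) (by fun_prop)
      _).eventually (ModelSpace.isOpen_lt_modelDiameter.mem_nhds ?_)
    exact hd.lt₂
  obtain ⟨η, hη, hnear⟩ := Metric.eventually_nhds_iff.1 (near.and hDn)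
  have hR1' : (M.tau z₁ z₂).toReal < R := by
    rwa [← ENNReal.toReal_lt_toReal (hfin z₁ z₂) ENNReal.coe_ne_top, ENNReal.coe_toReal] at hR1
  -- The tolerance `η` gives a hinge with `τ > R` for the new sides, and the other one keeps `τ` of
  -- the last two points below `R`.
  obtain ⟨i, p, hp⟩ := happ ![y, x, z₁, z₂] (min η (R - (M.tau z₁ z₂).toReal))
    (lt_min hη (by linarith))
  obtain ⟨a1, a2, a3⟩ := hp 0 1 hyx
  obtain ⟨b1, b2, b3⟩ := hp 1 2 h1
  obtain ⟨c1, c2, c3⟩ := hp 0 2 (M.ll_trans _ _ _ hyx h1)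
  obtain ⟨d1, d2, d3⟩ := hp 1 3 h2
  obtain ⟨e1, e2, e3⟩ := hp 0 3 (M.ll_trans _ _ _ hyx h2)
  obtain ⟨f1, f2, f3⟩ := hp 2 3 h12
  obtain ⟨n1, n2⟩ := hnear (y := (((L i).tau (p 0) (p 1)).toReal, ((L i).tau (p 1) (p 2)).toReal,
    ((L i).tau (p 0) (p 2)).toReal, ((L i).tau (p 1) (p 3)).toReal,
    ((L i).tau (p 0) (p 3)).toReal)) (by
      simp only [Prod.dist_eq, Real.dist_eq, max_lt_iff]
      exact ⟨a3.trans_le (min_le_left _ _), b3.trans_le (min_le_left _ _),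
        c3.trans_le (min_le_left _ _), d3.trans_le (min_le_left _ _),
        e3.trans_le (min_le_left _ _)⟩)
  simp only [ENNReal.ofReal_toReal e2] at n2
  obtain ⟨q', r', s', hq, hR⟩ := n1
    (add_toReal_le ((L i).le_of_ll _ _ a1) ((L i).le_of_ll _ _ b1) c2)
    (add_toReal_le ((L i).le_of_ll _ _ a1) ((L i).le_of_ll _ _ d1) e2)
  have hfinal := hL i _ _ _ _ a1 b1 ((L i).le_of_ll _ _ f1) n2 _ _ _ _
    ((isHinge_iff a1 b1 d1 c2 e2).1 hq)
  have h3 := hR.trans_le hfinal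
  rw [← ENNReal.toReal_lt_toReal ENNReal.coe_ne_top f2, ENNReal.coe_toReal] at h3
  have h4 := (abs_lt.1 (f3.trans_le (min_le_right _ _))).2
  simp only [Matrix.cons_val] at h4
  linarith

/-- Only a null pair `z₁ ≤ z₂` remains. It is reached from timelike pairs by moving `z₁` back along
a maximizing curve from `x`, after closing the angle of the comparison hinge. -/
lemma futureCurvatureGE_of_approximable (happ : Approximable L M)
    (hL : ∀ i, (L i).FutureCurvatureGE K) (hfin : ∀ x y, M.tau x y ≠ ⊤)
    (hcont : Continuous fun p : Z × Z => M.tau p.1 p.2) (hgeo : M.HasMaximizers) :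
    M.FutureCurvatureGE K := by
  intro y x z₁ z₂ hyx h1 h12 hD y' x' z₁' z₂' hc
  by_contra! hlt
  have hnull : M.tau z₁ z₂ = 0 := by
    by_contra h0
    exact hlt.not_ge (tau_le_of_approximable happ hL hfin hyx h1
      ((M.tau_pos_iff _ _).1 (pos_iff_ne_zero.2 h0)) hD hc)
  rw [hnull] at hlt
  have h2 : M.ll x z₂ := ll_of_ll_of_le h1 h12
  have lyx := M.le_of_ll _ _ hyx
  have lx1 := M.le_of_ll _ _ h1
  have hD1 : M.tau y z₁ < modelDiameter K :=
    (tau_left_le (M.le_trans _ _ _ lyx lx1) h12).trans_lt hD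
  have hd := hingeData hyx h1 h2 hD1 hD
  have hh := (isHinge_iff (K := K) hyx h1 h2 (hfin _ _) (hfin _ _)).2 hc
  have hne : x ≠ z₁ := by
    rintro rfl
    have := add_toReal_le lx1 lx1 (hfin x x)
    have := toReal_tau_pos h1 (hfin x x)
    linarith
  obtain ⟨α, β, γ, hαβ, γc, γα, γβ, γle, γmax⟩ := hgeo x z₁ lx1 hne
  have hα : α ∈ Icc α β := left_mem_Icc.2 hαβ.le
  have hβ : β ∈ Icc α β := right_mem_Icc.2 hαβ.le
  have tau_to : ∀ w, ContinuousOn (fun t => M.tau (γ t) w) (Icc α β) := fun w =>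
    hcont.comp_continuousOn (γc.prodMk continuousOn_const)
  have tau_from : ∀ w, ContinuousOn (fun t => M.tau w (γ t)) (Icc α β) := fun w =>
    hcont.comp_continuousOn (continuousOn_const.prodMk γc)
  have hle1 : ∀ t ∈ Icc α β, M.le (γ t) z₁ := fun t ht => γβ ▸ γle t ht β hβ ht.2
  have hlex : ∀ t ∈ Icc α β, M.le x (γ t) := fun t ht => γα ▸ γle α hα t ht ht.1
  have hEc : IsCompact (Icc α β ∩ (fun t => M.tau (γ t) z₂) ⁻¹' {0}) :=
    isCompact_Icc.of_isClosed_subset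
      ((tau_to z₂).preimage_isClosed_of_isClosed isClosed_Icc isClosed_singleton) inter_subset_left
  -- The first parameter at which the curve is no longer in the timelike past of `z₂`; `γ β = z₁`
  -- shows that there is one.
  obtain ⟨t₁, ⟨ht₁, h0⟩, hmin⟩ := hEc.exists_isLeast ⟨β, hβ, by simp [γβ, hnull]⟩
  simp only [mem_preimage, mem_singleton_iff] at h0
  have hαt : α < t₁ := by
    refine lt_of_le_of_ne ht₁.1 ?_
    rintro rfl
    rw [γα] at h0
    exact ((M.tau_pos_iff _ _).2 h2).ne' h0
  -- The remaining piece from `γ t₁` to `z₁` is null because `τ(γ t₁, z₁) ≤ τ(γ t₁, z₂) = 0`, so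
  -- maximality leaves all of `τ(x, z₁)` to the first piece.
  have hb : M.tau x (γ t₁) = M.tau x z₁ := by
    refine le_antisymm (tau_left_le (hlex _ ht₁) (hle1 _ ht₁)) ?_
    have h3 : M.tau (γ t₁) z₁ = 0 := by
      have := tau_left_le (hle1 _ ht₁) h12
      rw [h0] at this
      exact nonpos_iff_eq_zero.1 this
    simpa [h3] using γmax t₁ ht₁
  have hxt : M.ll x (γ t₁) := (M.tau_pos_iff _ _).1 (hb ▸ (M.tau_pos_iff _ _).2 h1)
  have hct : M.tau y (γ t₁) ≤ M.tau y z₁ :=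
    tau_left_le (M.le_trans _ _ _ lyx (hlex _ ht₁)) (hle1 _ ht₁)
  have hd' := hingeData hyx hxt h2 (hct.trans_lt hD1) hD
  obtain ⟨r', hr', hpos⟩ := hd.exists_slide hh hlt (c := (M.tau y (γ t₁)).toReal)
    (hb ▸ add_toReal_le lyx (hlex _ ht₁) (hfin _ _)) (ENNReal.toReal_mono (hfin _ _) hct)
  rw [← hb] at hr'
  obtain ⟨R, hR0, hR⟩ := exists_between hpos
  have near := hd'.exists_near hr' hR
  have hmono : 𝓝[<] t₁ ≤ 𝓝[Icc α β] t₁ := by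
    rw [nhdsWithin_le_iff]
    exact mem_of_superset (Ico_mem_nhdsLT hαt) (fun t ht => ⟨ht.1, ht.2.le.trans ht₁.2⟩)
  have lim : ∀ w, Tendsto (fun t => M.tau w (γ t)) (𝓝[<] t₁) (𝓝 (M.tau w (γ t₁))) :=
    fun w => (tau_from w t₁ ht₁).tendsto.mono_left hmono
  have limR : ∀ w, Tendsto (fun t => (M.tau w (γ t)).toReal) (𝓝[<] t₁)
      (𝓝 (M.tau w (γ t₁)).toReal) :=
    fun w => (ENNReal.tendsto_toReal (hfin _ _)).comp (lim w)
  have limv : Tendsto (fun t => ((M.tau y x).toReal, (M.tau x (γ t)).toReal,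
      (M.tau y (γ t)).toReal, (M.tau x z₂).toReal, (M.tau y z₂).toReal)) (𝓝[<] t₁)
      (𝓝 ((M.tau y x).toReal, (M.tau x (γ t₁)).toReal,
      (M.tau y (γ t₁)).toReal, (M.tau x z₂).toReal, (M.tau y z₂).toReal)) :=
    tendsto_const_nhds.prodMk_nhds ((limR x).prodMk_nhds ((limR y).prodMk_nhds
      tendsto_const_nhds))
  have lim2 : Tendsto (fun t => M.tau (γ t) z₂) (𝓝[<] t₁) (𝓝 0) := by
    have := (tau_to z₂ t₁ ht₁).tendsto.mono_left hmono
    rwa [h0] at this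
  -- Just before `t₁` the model separation exceeds `R`, whereas `τ(γ t, z₂)` is positive but below
  -- `R`.
  obtain ⟨t, k1, k2, k3, k4⟩ := ((limv.eventually near).and (((lim x).eventually
    (lt_mem_nhds ((M.tau_pos_iff _ _).2 hxt))).and ((lim2.eventually (gt_mem_nhds hR0)).and
      (Ico_mem_nhdsLT hαt)))).exists
  have ht : t ∈ Icc α β := ⟨k4.1, k4.2.le.trans ht₁.2⟩
  have hxt' := (M.tau_pos_iff _ _).1 k2
  have htz : M.ll (γ t) z₂ := by
    rw [← M.tau_pos_iff, pos_iff_ne_zero]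
    exact fun h => k4.2.not_ge (hmin ⟨ht, h⟩)
  obtain ⟨q', r'', s', m1, m2⟩ := k1 (add_toReal_le lyx (hlex _ ht) (hfin _ _))
    (add_toReal_le lyx (M.le_of_ll _ _ h2) (hfin _ _))
  have := tau_le_of_approximable happ hL hfin hyx hxt' htz hD
    ((isHinge_iff hyx hxt' h2 (hfin _ _) (hfin _ _)).1 m1)
  exact (m2.trans_le this).not_gt k3

end Limit

end LorentzianPreLengthSpace

/-! ### Consequences of `ℓ`-convergence -/

namespace LorentzianPreLengthSpace

variable {X : Type*} [MetricSpace X] {Z : Type*} [MetricSpace Z]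

lemma max_ell_zero (M : LorentzianPreLengthSpace Z) (x y : Z) :
    max (M.ell x y) 0 = (M.tau x y : EReal) := by
  rw [ell]
  split_ifs with h
  · exact max_eq_left (EReal.coe_ennreal_nonneg _)
  · simp [M.tau_eq_zero x y h]

lemma ell_le_tau (M : LorentzianPreLengthSpace Z) (x y : Z) :
    M.ell x y ≤ (M.tau x y : EReal) := by
  rw [← max_ell_zero]; exact le_max_left _ _

lemma ell_eq_tau {M : LorentzianPreLengthSpace Z} {x y : Z} (h : M.le x y) :
    M.ell x y = (M.tau x y : EReal) := by
  rw [ell, if_pos h]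

lemma tau_le_add_of_ell {N : LorentzianPreLengthSpace X} {M : LorentzianPreLengthSpace Z}
    {x' y' : X} {x y : Z} {ε : ℝ} (hε : 0 ≤ ε)
    (h : 0 ≤ N.ell x' y' → N.ell x' y' ≤ max (M.ell x y) 0 + (ε : EReal)) :
    N.tau x' y' ≤ M.tau x y + ENNReal.ofReal ε := by
  by_cases hl : N.le x' y'
  · rw [ell_eq_tau hl, max_ell_zero] at h
    have := h (EReal.coe_ennreal_nonneg _)
    rwa [← EReal.coe_ennreal_le_coe_ennreal_iff, EReal.coe_ennreal_add, EReal.coe_ennreal_ofReal,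
      max_eq_left hε]
  · rw [N.tau_eq_zero _ _ hl]; exact zero_le

lemma tau_le_add_of_le_ell {N : LorentzianPreLengthSpace X} {M : LorentzianPreLengthSpace Z}
    {x' y' : X} {x y : Z} {ε r : ℝ} (hε : 0 ≤ ε) (hr : 0 < r)
    (h : (r : EReal) ≤ M.ell x y → M.ell x y - (ε : EReal) ≤ N.ell x' y')
    (h' : ENNReal.ofReal r ≤ M.tau x y) :
    M.tau x y ≤ N.tau x' y' + ENNReal.ofReal ε := by
  have hl := M.le_of_ll _ _ ((M.tau_pos_iff _ _).1 ((ENNReal.ofReal_pos.2 hr).trans_le h'))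
  rw [ell_eq_tau hl] at h
  have h1 := (h (by
    rw [← EReal.coe_ennreal_le_coe_ennreal_iff, EReal.coe_ennreal_ofReal, max_eq_left hr.le] at h'
    exact h')).trans (N.ell_le_tau x' y')
  rw [EReal.sub_le_iff_le_add (Or.inl (EReal.coe_ne_bot _)) (Or.inl (EReal.coe_ne_top _))] at h1
  rwa [← EReal.coe_ennreal_le_coe_ennreal_iff, EReal.coe_ennreal_add, EReal.coe_ennreal_ofReal,
      max_eq_left hε]

lemma IsProperCover.monotone {M : LorentzianPreLengthSpace Z} {V : ℕ → Set Z}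
    (h : M.IsProperCover V) : Monotone V := monotone_nat_of_le_succ h.subset_succ

lemma IsProperCover.exists_mem {M : LorentzianPreLengthSpace Z} {V : ℕ → Set Z}
    (h : M.IsProperCover V) {ι : Type*} [Finite ι] (p : ι → Z) : ∃ k, ∀ m, p m ∈ V k := by
  have h1 : ∀ m, ∃ k, p m ∈ V k := fun m => mem_iUnion.1 (h.iUnion_eq ▸ mem_univ (p m))
  choose k hk using h1
  obtain ⟨K, hK⟩ := (finite_range k).bddAbove
  exact ⟨K, fun m => h.monotone (hK (mem_range_self m)) (hk m)⟩

lemma IsProperCover.tau_ne_top {M : LorentzianPreLengthSpace Z} {V : ℕ → Set Z}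
    (h : M.IsProperCover V) (x y : Z) : M.tau x y ≠ ⊤ := by
  obtain ⟨k, hk⟩ := h.exists_mem ![x, y]
  obtain ⟨C, hC⟩ := h.tau_bounded k
  exact ne_top_of_le_ne_top ENNReal.coe_ne_top (hC x (hk 0) y (hk 1))

variable {Y : ℕ → Type*} [∀ i, MetricSpace (Y i)] {L : ∀ i, LorentzianPreLengthSpace (Y i)}
  {U : ∀ i, ℕ → Set (Y i)} {M : LorentzianPreLengthSpace Z} {V : ℕ → Set Z}

/-- Consequences of `ℓ`-convergence for the time separation functions: points in the spaces `Y i`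
that are close to given points have nearly the same time separation. -/
lemma exists_approx (hconv : EllConverges L U M V) (k : ℕ) {l : ℕ} (hl : 0 < l) {ε : ℝ}
    (hε : 0 < ε) (hεl : ε < 1 / (2 * l)) :
    ∃ δ > 0, ∃ i, ∃ ψ : Y i → Z, (∀ z ∈ closure (V k), ∃ z' ∈ closure (U i k),
      dist (ψ z') z < δ) ∧
      ∀ x' ∈ closure (U i k), ∀ y' ∈ closure (U i k), ∀ x ∈ closure (V k), ∀ y ∈ closure (V k),
        dist (ψ x') x < 2 * δ → dist (ψ y') y < 2 * δ →
        (L i).tau x' y' ≤ M.tau x y + ENNReal.ofReal ε ∧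
        (ENNReal.ofReal (1 / l) ≤ M.tau x y →
          M.tau x y ≤ (L i).tau x' y' + ENNReal.ofReal ε) := by
  obtain ⟨-, φ, hgh, hs⟩ := hconv
  obtain ⟨δ, hδ, i₀, hi₀⟩ := hs k l hl ε hε hεl
  -- With `δ / 4` the two distances, each below `2 * (δ / 4)`, add up to at most `δ`; the factor `2`
  -- leaves room for a triangle inequality.
  obtain ⟨i, hi, hge⟩ := ((hgh k (δ / 4) (by positivity)).and (eventually_ge_atTop i₀)).exists
  refine ⟨δ / 4, by positivity, i, φ k i, hi.dense, fun x' hx' y' hy' x hx y hy h1 h2 => ?_⟩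
  obtain ⟨c1, c2⟩ := hi₀ i hge x' hx' y' hy' x hx y hy (by linarith)
  exact ⟨tau_le_add_of_ell hε.le c1, tau_le_add_of_le_ell hε.le (by positivity) c2⟩

lemma approximable_of_ellConverges (hconv : EllConverges L U M V) (hV : M.IsProperCover V) :
    Approximable L M := by
  intro p η hη
  obtain ⟨k, hk⟩ := hV.exists_mem p
  have hl : ∀ᶠ l : ℕ in atTop, ∀ m n, M.ll (p m) (p n) →
      ENNReal.ofReal (1 / l) ≤ M.tau (p m) (p n) := by
    refine eventually_all.2 fun m => eventually_all.2 fun n => ?_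
    by_cases h : M.ll (p m) (p n)
    · have h0 := toReal_tau_pos h (hV.tau_ne_top _ _)
      filter_upwards [tendsto_one_div_atTop_nhds_zero_nat.eventually (gt_mem_nhds h0)] with l hl _
      rw [← ENNReal.ofReal_toReal (hV.tau_ne_top (p m) (p n))]
      exact ENNReal.ofReal_le_ofReal hl.le
    · exact Eventually.of_forall fun _ h' => absurd h' h
  obtain ⟨l, hl, hl0⟩ := (hl.and (eventually_gt_atTop 0)).exists
  have hl0' : (0 : ℝ) < l := by exact_mod_cast hl0
  -- Besides accuracy `η`, `ε` must stay below the cutoff `1 / l`: then `τ ≥ 1 / l` in the limit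
  -- forces positive `τ` in `Y i`.
  set ε := min (η / 2) (1 / (4 * l)) with hε
  have hε0 : 0 < ε := by positivity
  have hεl : ε < 1 / (2 * l) := by
    refine (min_le_right _ _).trans_lt ?_
    gcongr
    norm_num
  obtain ⟨δ, hδ, i, ψ, h1, h2⟩ := exists_approx hconv k hl0 hε0 hεl
  choose p' hp' hd using fun m => h1 (p m) (subset_closure (hk m))
  refine ⟨i, p', fun m n hmn => ?_⟩
  obtain ⟨c1, c2⟩ := h2 (p' m) (hp' m) (p' n) (hp' n) (p m) (subset_closure (hk m)) (p n)
    (subset_closure (hk n)) (by linarith [hd m]) (by linarith [hd n])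
  have hfin := hV.tau_ne_top (p m) (p n)
  have hfin' : (L i).tau (p' m) (p' n) ≠ ⊤ :=
    ne_top_of_le_ne_top (ENNReal.add_ne_top.2 ⟨hfin, ENNReal.ofReal_ne_top⟩) c1
  have c3 := c2 (hl m n hmn)
  have c4 := hl m n hmn
  rw [← ENNReal.ofReal_toReal hfin, ← ENNReal.ofReal_toReal hfin',
    ← ENNReal.ofReal_add ENNReal.toReal_nonneg hε0.le,
    ENNReal.ofReal_le_ofReal_iff (add_nonneg ENNReal.toReal_nonneg hε0.le)] at c1 c3
  rw [← ENNReal.ofReal_toReal hfin, ENNReal.ofReal_le_ofReal_iff ENNReal.toReal_nonneg] at c4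
  have hlt : (1 : ℝ) / (2 * l) ≤ 1 / l := by
    gcongr
    linarith
  refine ⟨?_, hfin', ?_⟩
  · rw [← (L i).tau_pos_iff, pos_iff_ne_zero]
    intro h0
    rw [h0, ENNReal.toReal_zero] at c3
    linarith
  · have : ε ≤ η / 2 := min_le_left _ _
    rw [abs_lt]
    constructor <;> linarith

/-- Lower semicontinuity is an axiom. For upper semicontinuity, points of some `Y i` near `(u, v)`
are also near `(x, y)`, and comparing both pairs with them gives `τ(u, v) ≤ τ(x, y) + 2ε`. The
neighbourhood condition puts all nearby points in one set of the cover. -/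
lemma continuous_tau_of_ellConverges (hconv : EllConverges L U M V) (hV : M.IsProperCover V)
    (hV_nhds : ∀ z : Z, ∃ k, closure (V k) ∈ 𝓝 z) :
    Continuous fun p : Z × Z => M.tau p.1 p.2 := by
  refine continuous_iff_lower_upperSemicontinuous.2 ⟨M.lowerSemicontinuous_tau, ?_⟩
  rintro ⟨x, y⟩ c hc
  simp only at hc
  obtain ⟨R, hR1, hR2⟩ := ENNReal.lt_iff_exists_nnreal_btwn.1 hc
  have hfin := hV.tau_ne_top x y
  rw [← ENNReal.toReal_lt_toReal hfin ENNReal.coe_ne_top, ENNReal.coe_toReal] at hR1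
  obtain ⟨k₁, hk₁⟩ := hV_nhds x
  obtain ⟨k₂, hk₂⟩ := hV_nhds y
  have hx : closure (V (max k₁ k₂)) ∈ 𝓝 x :=
    mem_of_superset hk₁ (closure_mono (hV.monotone (le_max_left _ _)))
  have hy : closure (V (max k₁ k₂)) ∈ 𝓝 y :=
    mem_of_superset hk₂ (closure_mono (hV.monotone (le_max_right _ _)))
  set k := max k₁ k₂
  -- With `1 / l < R - τ(x, y)`, pairs whose `τ` is below the cutoff `1 / l` satisfy the bound
  -- anyway.
  obtain ⟨l, hl, hl0⟩ := ((tendsto_one_div_atTop_nhds_zero_nat (𝕜 := ℝ)).eventually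
    (gt_mem_nhds (sub_pos.2 hR1)) |>.and (eventually_gt_atTop 0)).exists
  have hl0' : (0 : ℝ) < l := by exact_mod_cast hl0
  have hεl : (1 : ℝ) / (4 * l) < 1 / (2 * l) := by gcongr; norm_num
  have hε0 : (0 : ℝ) < 1 / (4 * l) := by positivity
  have hε4 : (1 : ℝ) / (4 * l) + 1 / (4 * l) ≤ 1 / l := by
    have : (1 : ℝ) / (4 * l) = 1 / l / 4 := by field_simp
    have : (0 : ℝ) < 1 / l := by positivity
    linarith
  obtain ⟨δ, hδ, i, ψ, h1, h2⟩ := exists_approx hconv k hl0 hε0 hεl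
  filter_upwards [prod_mem_nhds (inter_mem hx (Metric.ball_mem_nhds x hδ))
    (inter_mem hy (Metric.ball_mem_nhds y hδ))]
  rintro ⟨u, v⟩ ⟨⟨hu, hu'⟩, ⟨hv, hv'⟩⟩
  simp only [Metric.mem_ball] at hu' hv' ⊢
  refine lt_of_le_of_lt ?_ hR2
  by_cases huv : ENNReal.ofReal (1 / l) ≤ M.tau u v
  · obtain ⟨u', hu1, hu2⟩ := h1 u hu
    obtain ⟨v', hv1, hv2⟩ := h1 v hv
    have e1 := (h2 u' hu1 v' hv1 u hu v hv (by linarith) (by linarith)).2 huv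
    have e2 := (h2 u' hu1 v' hv1 x (mem_of_mem_nhds hx) y (mem_of_mem_nhds hy)
      (by linarith [dist_triangle (ψ u') u x]) (by linarith [dist_triangle (ψ v') v y])).1
    calc M.tau u v ≤ M.tau x y + ENNReal.ofReal (1 / (4 * l)) + ENNReal.ofReal (1 / (4 * l)) :=
          e1.trans (by gcongr)
      _ = ENNReal.ofReal ((M.tau x y).toReal + (1 / (4 * l) + 1 / (4 * l))) := by
          rw [ENNReal.ofReal_add ENNReal.toReal_nonneg (by positivity),
            ENNReal.ofReal_add hε0.le hε0.le, ENNReal.ofReal_toReal hfin, add_assoc]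
      _ ≤ ENNReal.ofReal R := ENNReal.ofReal_le_ofReal (by linarith)
      _ = R := ENNReal.ofReal_coe_nnreal
  · rw [← ENNReal.ofReal_coe_nnreal]
    refine (not_le.1 huv).le.trans (ENNReal.ofReal_le_ofReal ?_)
    have : 0 ≤ (M.tau x y).toReal := ENNReal.toReal_nonneg
    linarith

end LorentzianPreLengthSpace

/-! ### The curvature bound of the limit -/

theorem mainTheorem8 (K : ℝ)
    {Y : ℕ → Type*} [∀ i, MetricSpace (Y i)] {Z : Type*} [MetricSpace Z]
    (L : ∀ i, LorentzianPreLengthSpace (Y i)) (U : ∀ i, ℕ → Set (Y i))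
    (M : LorentzianPreLengthSpace Z) (V : ℕ → Set Z)
    (hL : ∀ i, (L i).IsGeodesic) (hU : ∀ i, (L i).IsProperCover (U i))
    (hM : M.IsGeodesic) (hV : M.IsProperCover V)
    (hV_nhds : ∀ z : Z, ∃ k, closure (V k) ∈ 𝓝 z)
    (hcurv : ∀ i, (L i).HasGlobalTimelikeCurvatureGE K)
    (hconv : EllConverges L U M V) :
    M.HasTimelikeCurvatureGE K := by
  have happ := LorentzianPreLengthSpace.approximable_of_ellConverges hconv hV
  have hfin := hV.tau_ne_top
  have hcont := LorentzianPreLengthSpace.continuous_tau_of_ellConverges hconv hV hV_nhds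
  have hgeo := hM.hasMaximizers
  have hfut : M.FutureCurvatureGE K :=
    LorentzianPreLengthSpace.futureCurvatureGE_of_approximable happ
      (fun i y x z₁ z₂ => (hcurv i).future y trivial x trivial z₁ trivial z₂ trivial)
      hfin hcont hgeo
  have hpast : M.PastCurvatureGE K := by
    refine LorentzianPreLengthSpace.FutureCurvatureGE.of_reverse
      (LorentzianPreLengthSpace.futureCurvatureGE_of_approximable happ.reverse
        (fun i => LorentzianPreLengthSpace.PastCurvatureGE.reverse ?_)
        (fun x y => hfin y x) (hcont.comp continuous_swap) hgeo.reverse)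
    exact fun z₂ z₁ x y => (hcurv i).past z₂ trivial z₁ trivial x trivial y trivial
  -- The bound holds globally, so the whole space serves as a comparison neighbourhood of every
  -- point.
  refine fun z => ⟨univ, trivial, isOpen_univ, ?_, hcont.continuousOn, ?_, ?_⟩
  · rw [univ_prod_univ, univ_inter]
    exact isOpen_lt hcont continuous_const
  · exact fun y _ x _ z₁ _ z₂ _ => hfut y x z₁ z₂
  · exact fun z₂ _ z₁ _ x _ y _ => hpast z₂ z₁ x y
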